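/- Let $q\in\mathbb C^*$ be generic, that is, not a root of unity, and let $c\in\mathbb C$. Let $U_q(\mathfrak{sl}_2)$ be the unital $\mathbb C$-algebra generated by $E,F,K,K^{-1}$ with relations $KK^{-1}=K^{-1}K=1$, $KEK^{-1}=q^2E$, $KFK^{-1}=q^{-2}F$, $EF-FE=\frac{K-K^{-1}}{q-q^{-1}}$, let $Z_q=EF+\frac{q^{-1}K+qK^{-1}}{(q-q^{-1})^2}$, and let $U_c=U_q(\mathfrak{sl}_2)/(Z_q-c)$. Put $\nu=q^2$, let $R=\mathbb C_\nu[x^{\pm1},y^{\pm1}]$ be the quantum torus with defining relation $\nu xy=yx$, and let $B=\mathbb C(x)[y,y^{-1}]$ be the skew Laurent polynomial ring with $yf(x)=f(\nu x)y$ for $f\in\mathbb C(x)$. Let $\varphi:U_c\to R$ be the algebra homomorphism with $F\mapsto y$, $K^{\pm1}\mapsto x^{\pm1}$, $E\mapsto cy^{-1}-\frac{1}{(q-q^{-1})^2}(q^{-1}x+qx^{-1})y^{-1}$. Then $\varphi$ and the canonical map $R\to B$ ($x^{\pm1}\mapsto x^{\pm1}$, $y^{\pm1}\mapsto y^{\pm1}$)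 are injective. Regard $R_c=\varphi(U_c)$ as a subalgebra of $B$, and $R_c$-modules as $U_c$-modules through $\varphi$. If $V$ is a simple left $U_c$-module, then at least one of the following holds: (i) $V$ is a lowest weight module: it is generated by a nonzero vector $v$ with $Fv=0$ and $Kv\in\mathbb Cv$; (ii) $V$ is a highest weight module: it is generated by a nonzero vector $v$ with $Ev=0$ and $Kv\in\mathbb Cv$; (iii) $V$ is a (simple) module of the intermediate series: for some $\lambda\in\mathbb C^*$, $V$ is the sum of the weight spaces $\{v\in V: Kv=\lambda q^{2i}v\}$, $i\in\mathbb Z$, and each of these is one-dimensional; (iv) there is an $\alpha\in R_c$, irreducible in $B$, such that $V\cong(R_c+B\alpha)/B\alpha$ as $U_c$-modules. -/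

import Mathlib

noncomputable section

/-! ### The quantum group `U_q(sl₂)` and its central quotients -/

/-- The generators `E, F, K, K⁻¹` of `U_q(sl₂)`. -/
inductive UqGen : Type
  | E | F | K | Kinv

namespace UqGen

/-- A generator, as an element of the free algebra. -/
abbrev free (g : UqGen) : FreeAlgebra ℂ UqGen := FreeAlgebra.ι ℂ g

end UqGen

/-- The defining relations of `U_q(sl₂)`. -/
inductive UqRel (q : ℂˣ) : FreeAlgebra ℂ UqGen → FreeAlgebra ℂ UqGen → Prop
  | K_mul_Kinv : UqRel q (UqGen.K.free * UqGen.Kinv.free) 1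
  | Kinv_mul_K : UqRel q (UqGen.Kinv.free * UqGen.K.free) 1
  | K_E : UqRel q (UqGen.K.free * UqGen.E.free * UqGen.Kinv.free)
      (((q : ℂ) ^ 2) • UqGen.E.free)
  | K_F : UqRel q (UqGen.K.free * UqGen.F.free * UqGen.Kinv.free)
      (((q : ℂ) ^ 2)⁻¹ • UqGen.F.free)
  | E_F : UqRel q (UqGen.E.free * UqGen.F.free - UqGen.F.free * UqGen.E.free)
      (((q : ℂ) - (q : ℂ)⁻¹)⁻¹ • (UqGen.K.free - UqGen.Kinv.free))

/-- The quantum group `U_q(sl₂)`: the unital `ℂ`-algebra on `E, F, K, K⁻¹` with the relations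
above. -/
def Uq (q : ℂˣ) : Type := RingQuot (UqRel q)

namespace Uq

instance (q : ℂˣ) : Ring (Uq q) := inferInstanceAs (Ring (RingQuot (UqRel q)))
instance (q : ℂˣ) : Algebra ℂ (Uq q) := inferInstanceAs (Algebra ℂ (RingQuot (UqRel q)))

/-- The image of a generator in `U_q(sl₂)`. -/
def gen (q : ℂˣ) (g : UqGen) : Uq q := RingQuot.mkAlgHom ℂ (UqRel q) g.free

/-- The Casimir element `Z_q = E F + (q⁻¹ K + q K⁻¹) / (q - q⁻¹)²`. -/
def casimir (q : ℂˣ) : Uq q :=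
  gen q .E * gen q .F +
    (((q : ℂ) - (q : ℂ)⁻¹) ^ 2)⁻¹ • ((q : ℂ)⁻¹ • gen q .K + (q : ℂ) • gen q .Kinv)

/-- A map on generators that satisfies the relations extends to an algebra homomorphism. -/
def lift {A : Type*} [Ring A] [Algebra ℂ A] (q : ℂˣ) (f : UqGen → A)
    (hf : ∀ ⦃a b⦄, UqRel q a b → FreeAlgebra.lift ℂ f a = FreeAlgebra.lift ℂ f b) :
    Uq q →ₐ[ℂ] A :=
  RingQuot.liftAlgHom ℂ ⟨FreeAlgebra.lift ℂ f, hf⟩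

theorem lift_gen {A : Type*} [Ring A] [Algebra ℂ A] (q : ℂˣ) (f : UqGen → A)
    (hf : ∀ ⦃a b⦄, UqRel q a b → FreeAlgebra.lift ℂ f a = FreeAlgebra.lift ℂ f b) (g : UqGen) :
    lift q f hf (gen q g) = f g := by
  unfold lift gen
  exact (RingQuot.liftAlgHom_mkAlgHom_apply ℂ _ hf _).trans (FreeAlgebra.lift_ι_apply _ _)

end Uq

/-- The single relation `Z_q = c`. -/
inductive UcRel (q : ℂˣ) (c : ℂ) : Uq q → Uq q → Prop
  | casimir : UcRel q c (Uq.casimir q) (algebraMap ℂ (Uq q) c)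

/-- The algebra `U_c = U_q(sl₂) / (Z_q - c)`: the quotient of `U_q(sl₂)` by the smallest ring
congruence with `Z_q ∼ c`, that is, by the two-sided ideal generated by `Z_q - c`. -/
def Uc (q : ℂˣ) (c : ℂ) : Type := RingQuot (UcRel q c)

namespace Uc

instance (q : ℂˣ) (c : ℂ) : Ring (Uc q c) := inferInstanceAs (Ring (RingQuot (UcRel q c)))
instance (q : ℂˣ) (c : ℂ) : Algebra ℂ (Uc q c) :=
  inferInstanceAs (Algebra ℂ (RingQuot (UcRel q c)))

/-- The quotient map `U_q(sl₂) → U_c`. -/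
def mk (q : ℂˣ) (c : ℂ) : Uq q →ₐ[ℂ] Uc q c := RingQuot.mkAlgHom ℂ (UcRel q c)

/-- The image of a generator of `U_q(sl₂)` in `U_c`. -/
def gen (q : ℂˣ) (c : ℂ) (g : UqGen) : Uc q c := mk q c (Uq.gen q g)

end Uc

/-! ### The quantum torus -/

/-- The generators `x, x⁻¹, y, y⁻¹` of the quantum torus. -/
inductive TorusGen : Type
  | x | xinv | y | yinv

namespace TorusGen

/-- A generator, as an element of the free algebra. -/
abbrev free (g : TorusGen) : FreeAlgebra ℂ TorusGen := FreeAlgebra.ι ℂ g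

end TorusGen

/-- The relations of the quantum torus: `x`, `y` are invertible and `ν x y = y x`. -/
inductive TorusRel (ν : ℂˣ) : FreeAlgebra ℂ TorusGen → FreeAlgebra ℂ TorusGen → Prop
  | x_mul_xinv : TorusRel ν (TorusGen.x.free * TorusGen.xinv.free) 1
  | xinv_mul_x : TorusRel ν (TorusGen.xinv.free * TorusGen.x.free) 1
  | y_mul_yinv : TorusRel ν (TorusGen.y.free * TorusGen.yinv.free) 1
  | yinv_mul_y : TorusRel ν (TorusGen.yinv.free * TorusGen.y.free) 1
  | x_y : TorusRel ν ((ν : ℂ) • (TorusGen.x.free * TorusGen.y.free))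
      (TorusGen.y.free * TorusGen.x.free)

/-- The quantum torus `R = ℂ_ν[x^{±1}, y^{±1}]`. -/
def QTorus (ν : ℂˣ) : Type := RingQuot (TorusRel ν)

namespace QTorus

instance (ν : ℂˣ) : Ring (QTorus ν) := inferInstanceAs (Ring (RingQuot (TorusRel ν)))
instance (ν : ℂˣ) : Algebra ℂ (QTorus ν) :=
  inferInstanceAs (Algebra ℂ (RingQuot (TorusRel ν)))

/-- The image of a generator in the quantum torus. -/
def gen (ν : ℂˣ) (g : TorusGen) : QTorus ν := RingQuot.mkAlgHom ℂ (TorusRel ν) g.free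

/-- A map on generators that satisfies the relations extends to an algebra homomorphism. -/
def lift {A : Type*} [Ring A] [Algebra ℂ A] (ν : ℂˣ) (f : TorusGen → A)
    (hf : ∀ ⦃a b⦄, TorusRel ν a b → FreeAlgebra.lift ℂ f a = FreeAlgebra.lift ℂ f b) :
    QTorus ν →ₐ[ℂ] A :=
  RingQuot.liftAlgHom ℂ ⟨FreeAlgebra.lift ℂ f, hf⟩

theorem lift_gen {A : Type*} [Ring A] [Algebra ℂ A] (ν : ℂˣ) (f : TorusGen → A)
    (hf : ∀ ⦃a b⦄, TorusRel ν a b → FreeAlgebra.lift ℂ f a = FreeAlgebra.lift ℂ f b)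
    (g : TorusGen) : lift ν f hf (gen ν g) = f g := by
  unfold lift gen
  exact (RingQuot.liftAlgHom_mkAlgHom_apply ℂ _ hf _).trans (FreeAlgebra.lift_ι_apply _ _)

theorem x_mul_xinv (ν : ℂˣ) : gen ν .x * gen ν .xinv = 1 := by
  have := RingQuot.mkAlgHom_rel ℂ (TorusRel.x_mul_xinv (ν := ν))
  simp only [map_mul, map_one] at this
  exact this

theorem xinv_mul_x (ν : ℂˣ) : gen ν .xinv * gen ν .x = 1 := by
  have := RingQuot.mkAlgHom_rel ℂ (TorusRel.xinv_mul_x (ν := ν))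
  simp only [map_mul, map_one] at this
  exact this

theorem y_mul_yinv (ν : ℂˣ) : gen ν .y * gen ν .yinv = 1 := by
  have := RingQuot.mkAlgHom_rel ℂ (TorusRel.y_mul_yinv (ν := ν))
  simp only [map_mul, map_one] at this
  exact this

theorem yinv_mul_y (ν : ℂˣ) : gen ν .yinv * gen ν .y = 1 := by
  have := RingQuot.mkAlgHom_rel ℂ (TorusRel.yinv_mul_y (ν := ν))
  simp only [map_mul, map_one] at this
  exact this

theorem y_mul_x (ν : ℂˣ) : gen ν .y * gen ν .x = (ν : ℂ) • (gen ν .x * gen ν .y) := by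
  have := RingQuot.mkAlgHom_rel ℂ (TorusRel.x_y (ν := ν))
  simp only [map_mul, map_smul] at this
  exact this.symm

theorem y_mul_xinv (ν : ℂˣ) :
    gen ν .y * gen ν .xinv = (ν : ℂ)⁻¹ • (gen ν .xinv * gen ν .y) := by
  have h : gen ν .xinv * (gen ν .y * gen ν .x) * gen ν .xinv =
      (ν : ℂ) • (gen ν .y * gen ν .xinv) := by
    rw [y_mul_x, mul_smul_comm, smul_mul_assoc, ← mul_assoc, xinv_mul_x, one_mul]
  rw [mul_assoc, mul_assoc, x_mul_xinv, mul_one] at h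
  rw [h, smul_smul, inv_mul_cancel₀ ν.ne_zero, one_smul]

theorem yinv_mul_x (ν : ℂˣ) :
    gen ν .yinv * gen ν .x = (ν : ℂ)⁻¹ • (gen ν .x * gen ν .yinv) := by
  have h : gen ν .yinv * (gen ν .y * gen ν .x) * gen ν .yinv =
      (ν : ℂ) • (gen ν .yinv * gen ν .x) := by
    rw [y_mul_x, mul_smul_comm, smul_mul_assoc, mul_assoc, mul_assoc, y_mul_yinv, mul_one]
  rw [← mul_assoc, yinv_mul_y, one_mul] at h
  rw [h, smul_smul, inv_mul_cancel₀ ν.ne_zero, one_smul]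

theorem yinv_mul_xinv (ν : ℂˣ) :
    gen ν .yinv * gen ν .xinv = (ν : ℂ) • (gen ν .xinv * gen ν .yinv) := by
  have h : gen ν .xinv * (gen ν .yinv * gen ν .x) * gen ν .xinv =
      (ν : ℂ)⁻¹ • (gen ν .yinv * gen ν .xinv) := by
    rw [yinv_mul_x, mul_smul_comm, smul_mul_assoc, ← mul_assoc, xinv_mul_x, one_mul]
  rw [mul_assoc, mul_assoc, x_mul_xinv, mul_one] at h
  rw [h, smul_smul, mul_inv_cancel₀ ν.ne_zero, one_smul]

end QTorus

/-! ### The localization `B = ℂ(x)[y, y⁻¹]` -/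

/-- The field `ℂ(x)`, as a type that remembers the automorphism `f(x) ↦ f(ν x)`. -/
def TwistedRatFunc (_ν : ℂˣ) : Type := RatFunc ℂ

namespace TwistedRatFunc

instance (ν : ℂˣ) : Field (TwistedRatFunc ν) := inferInstanceAs (Field (RatFunc ℂ))
instance (ν : ℂˣ) : Algebra ℂ (TwistedRatFunc ν) := inferInstanceAs (Algebra ℂ (RatFunc ℂ))
instance (ν : ℂˣ) : Algebra (Polynomial ℂ) (TwistedRatFunc ν) :=
  inferInstanceAs (Algebra (Polynomial ℂ) (RatFunc ℂ))
instance (ν : ℂˣ) : IsScalarTower ℂ (Polynomial ℂ) (TwistedRatFunc ν) :=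
  inferInstanceAs (IsScalarTower ℂ (Polynomial ℂ) (RatFunc ℂ))
instance (ν : ℂˣ) : IsFractionRing (Polynomial ℂ) (TwistedRatFunc ν) :=
  inferInstanceAs (IsFractionRing (Polynomial ℂ) (RatFunc ℂ))

/-- The variable `x` of `ℂ(x)`. -/
def X (ν : ℂˣ) : TwistedRatFunc ν := algebraMap (Polynomial ℂ) (TwistedRatFunc ν) Polynomial.X

theorem X_ne_zero (ν : ℂˣ) : X ν ≠ 0 := by
  unfold X
  rw [Ne, FaithfulSMul.algebraMap_eq_zero_iff]
  exact Polynomial.X_ne_zero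

/-- The automorphism `f(x) ↦ f(ν x)` of `ℂ(x)`. -/
def scale (ν : ℂˣ) : TwistedRatFunc ν ≃ₐ[ℂ] TwistedRatFunc ν :=
  letI : Invertible (ν : ℂ) := ν.invertible
  IsFractionRing.algEquivOfAlgEquiv (Polynomial.algEquivCMulXAddC (ν : ℂ) 0)

theorem scale_X (ν : ℂˣ) : scale ν (X ν) = (ν : ℂ) • X ν := by
  let _ : Invertible (ν : ℂ) := ν.invertible
  unfold scale X
  rw [IsFractionRing.algEquivOfAlgEquiv_algebraMap]
  simp [Polynomial.algEquivCMulXAddC, Polynomial.C_mul']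
  rw [Algebra.smul_def, Algebra.smul_def, map_mul,
    IsScalarTower.algebraMap_apply ℂ (Polynomial ℂ) (TwistedRatFunc ν)]

/-- The action of `ℤ` on `ℂ(x)` in which the generator acts by `f(x) ↦ f(ν x)`. -/
instance (ν : ℂˣ) : MulSemiringAction (Multiplicative ℤ) (TwistedRatFunc ν) :=
  MulSemiringAction.compHom (TwistedRatFunc ν)
    (zpowersHom (TwistedRatFunc ν ≃ₐ[ℂ] TwistedRatFunc ν) (scale ν))

theorem ofAdd_smul (ν : ℂˣ) (n : ℤ) (f : TwistedRatFunc ν) :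
    Multiplicative.ofAdd n • f = (scale ν ^ n) f := rfl

instance (ν : ℂˣ) : SMulCommClass (Multiplicative ℤ) ℂ (TwistedRatFunc ν) where
  smul_comm n a f := map_smul (scale ν ^ n.toAdd) a f

end TwistedRatFunc

/-- The skew Laurent polynomial ring `B = ℂ(x)[y, y⁻¹]`, with `y f(x) = f(ν x) y`: the left
`ℂ(x)`-vector space with basis `yⁿ`, `n ∈ ℤ`, and `(f yᵐ)(g yⁿ) = f(x) g(νᵐ x) yᵐ⁺ⁿ`.
It is the localization of the quantum torus at `ℂ[x, x⁻¹] \ {0}`. -/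
def SkewLaurent (ν : ℂˣ) : Type := SkewMonoidAlgebra (TwistedRatFunc ν) (Multiplicative ℤ)

namespace SkewLaurent

instance (ν : ℂˣ) : Ring (SkewLaurent ν) :=
  inferInstanceAs (Ring (SkewMonoidAlgebra (TwistedRatFunc ν) (Multiplicative ℤ)))
instance (ν : ℂˣ) : Algebra ℂ (SkewLaurent ν) :=
  inferInstanceAs (Algebra ℂ (SkewMonoidAlgebra (TwistedRatFunc ν) (Multiplicative ℤ)))

/-- The monomial `f(x) yⁿ` of `B`. -/
def mono (ν : ℂˣ) (f : TwistedRatFunc ν) (n : ℤ) : SkewLaurent ν :=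
  SkewMonoidAlgebra.single (Multiplicative.ofAdd n) f

theorem mono_mul_mono (ν : ℂˣ) (f g : TwistedRatFunc ν) (m n : ℤ) :
    mono ν f m * mono ν g n = mono ν (f * (TwistedRatFunc.scale ν ^ m) g) (m + n) := by
  unfold mono
  exact SkewMonoidAlgebra.single_mul_single

theorem one_eq_mono (ν : ℂˣ) : (1 : SkewLaurent ν) = mono ν 1 0 := rfl

theorem smul_mono (ν : ℂˣ) (a : ℂ) (f : TwistedRatFunc ν) (n : ℤ) :
    a • mono ν f n = mono ν (a • f) n := by
  unfold mono
  exact SkewMonoidAlgebra.smul_single _ _ _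

/-- The values in `B` of the generators of the quantum torus. -/
def torusGen (ν : ℂˣ) : TorusGen → SkewLaurent ν
  | .x => mono ν (TwistedRatFunc.X ν) 0
  | .xinv => mono ν (TwistedRatFunc.X ν)⁻¹ 0
  | .y => mono ν 1 1
  | .yinv => mono ν 1 (-1)

theorem torusGen_rel (ν : ℂˣ) ⦃a b : FreeAlgebra ℂ TorusGen⦄ (h : TorusRel ν a b) :
    FreeAlgebra.lift ℂ (torusGen ν) a = FreeAlgebra.lift ℂ (torusGen ν) b := by
  have hX := TwistedRatFunc.X_ne_zero ν
  cases h <;>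
    simp [torusGen, mono_mul_mono, one_eq_mono, smul_mono, TwistedRatFunc.scale_X, hX]

end SkewLaurent

/-- The inclusion of the quantum torus `R` into its localization `B`. -/
def QTorus.toSkewLaurent (ν : ℂˣ) : QTorus ν →ₐ[ℂ] SkewLaurent ν :=
  QTorus.lift ν (SkewLaurent.torusGen ν) (SkewLaurent.torusGen_rel ν)

/-! ### The embedding of `U_c` into the quantum torus -/

namespace Uc

/-- The images in the quantum torus (with `ν = q²`) of the generators of `U_q(sl₂)`:
`F ↦ y`, `K^{±1} ↦ x^{±1}` and `E ↦ c y⁻¹ - (q - q⁻¹)⁻² (q⁻¹ x + q x⁻¹) y⁻¹`. -/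
def torusGen (q : ℂˣ) (c : ℂ) : UqGen → QTorus (q ^ 2)
  | .F => QTorus.gen (q ^ 2) .y
  | .K => QTorus.gen (q ^ 2) .x
  | .Kinv => QTorus.gen (q ^ 2) .xinv
  | .E => c • QTorus.gen (q ^ 2) .yinv -
      (((q : ℂ) - (q : ℂ)⁻¹) ^ 2)⁻¹ •
        (((q : ℂ)⁻¹ • QTorus.gen (q ^ 2) .x + (q : ℂ) • QTorus.gen (q ^ 2) .xinv) *
          QTorus.gen (q ^ 2) .yinv)


/-- The values on the generators satisfy the relations of `U_q(sl₂)`. -/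
theorem torusGen_rel (q : ℂˣ) (c : ℂ) ⦃a b : FreeAlgebra ℂ UqGen⦄ (h : UqRel q a b) :
    FreeAlgebra.lift ℂ (torusGen q c) a = FreeAlgebra.lift ℂ (torusGen q c) b := by
  have hq : (q : ℂ) ≠ 0 := q.ne_zero
  have h1 := QTorus.x_mul_xinv (q ^ 2)
  have h2 := QTorus.xinv_mul_x (q ^ 2)
  have h3 := QTorus.y_mul_yinv (q ^ 2)
  have h4 := QTorus.yinv_mul_y (q ^ 2)
  have h5 := QTorus.y_mul_x (q ^ 2)
  have h6 := QTorus.y_mul_xinv (q ^ 2)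
  have h7 := QTorus.yinv_mul_x (q ^ 2)
  have h8 := QTorus.yinv_mul_xinv (q ^ 2)
  rw [Units.val_pow_eq_pow_val] at h5 h6 h7 h8
  cases h
  all_goals
    simp only [map_mul, map_sub, map_smul, map_one, FreeAlgebra.lift_ι_apply, torusGen]
  all_goals
    generalize QTorus.gen (q ^ 2) .x = x at *
    generalize QTorus.gen (q ^ 2) .xinv = x' at *
    generalize QTorus.gen (q ^ 2) .y = y at *
    generalize QTorus.gen (q ^ 2) .yinv = y' at *
  · exact h1
  · exact h2
  · have hx : x * (x' * y') = y' := by rw [← mul_assoc, h1, one_mul]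
    simp only [mul_sub, sub_mul, mul_add, add_mul, mul_assoc, mul_smul_comm, smul_mul_assoc,
      h8, hx]
    module
  · have hx : x * (x' * y) = y := by rw [← mul_assoc, h1, one_mul]
    rw [mul_assoc, h6, mul_smul_comm, hx]
  · have hd : (((q : ℂ) - (q : ℂ)⁻¹) ^ 2)⁻¹ * ((q : ℂ) - (q : ℂ)⁻¹) =
        ((q : ℂ) - (q : ℂ)⁻¹)⁻¹ := by
      rcases eq_or_ne ((q : ℂ) - (q : ℂ)⁻¹) 0 with h0 | h0
      · simp [h0]
      · field_simp
    have hx : y * (x * y') = ((q : ℂ) ^ 2) • x := by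
      rw [← mul_assoc, h5, smul_mul_assoc, mul_assoc, h3, mul_one]
    have hx' : y * (x' * y') = ((q : ℂ) ^ 2)⁻¹ • x' := by
      rw [← mul_assoc, h6, smul_mul_assoc, mul_assoc, h3, mul_one]
    have e1 : (q : ℂ)⁻¹ * (q : ℂ) ^ 2 = q := by field_simp
    have e2 : (q : ℂ) * ((q : ℂ) ^ 2)⁻¹ = (q : ℂ)⁻¹ := by field_simp
    simp only [mul_sub, sub_mul, mul_add, add_mul, mul_assoc, mul_smul_comm, smul_mul_assoc,
      h3, h4, hx, hx', mul_one, smul_smul, e1, e2, ← hd]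
    module

/-- The map `U_q(sl₂) → R` before passing to the quotient. -/
def uqToTorus (q : ℂˣ) (c : ℂ) : Uq q →ₐ[ℂ] QTorus (q ^ 2) :=
  Uq.lift q (torusGen q c) (torusGen_rel q c)

theorem uqToTorus_rel (q : ℂˣ) (c : ℂ) ⦃a b : Uq q⦄ (h : UcRel q c a b) :
    uqToTorus q c a = uqToTorus q c b := by
  have h4 := QTorus.yinv_mul_y (q ^ 2)
  cases h
  rw [AlgHom.commutes, Algebra.algebraMap_eq_smul_one]
  simp only [Uq.casimir, uqToTorus, map_add, map_mul, map_smul, Uq.lift_gen, torusGen]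
  simp only [sub_mul, add_mul, mul_assoc, smul_mul_assoc, h4, mul_one]
  module

/-- The homomorphism `φ : U_c → R = ℂ_ν[x^{±1}, y^{±1}]`, `ν = q²`. -/
def toTorus (q : ℂˣ) (c : ℂ) : Uc q c →ₐ[ℂ] QTorus (q ^ 2) :=
  RingQuot.liftAlgHom ℂ ⟨uqToTorus q c, uqToTorus_rel q c⟩

theorem toTorus_gen (q : ℂˣ) (c : ℂ) (g : UqGen) :
    toTorus q c (gen q c g) = torusGen q c g := by
  unfold toTorus gen mk
  exact (RingQuot.liftAlgHom_mkAlgHom_apply ℂ _ (uqToTorus_rel q c) _).trans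
    (Uq.lift_gen _ _ _ _)

/-- `φ`, followed by the inclusion of the quantum torus into `B = ℂ(x)[y, y⁻¹]`. -/
def toSkewLaurent (q : ℂˣ) (c : ℂ) : Uc q c →ₐ[ℂ] SkewLaurent (q ^ 2) :=
  (QTorus.toSkewLaurent (q ^ 2)).comp (toTorus q c)

/-- The algebra `R_c = φ(U_c)`, as a subalgebra of `B`. -/
def image (q : ℂˣ) (c : ℂ) : Subalgebra ℂ (SkewLaurent (q ^ 2)) := (toSkewLaurent q c).range

/-- The map `U_c → R_c` given by `φ`. -/
def toImage (q : ℂˣ) (c : ℂ) : Uc q c →ₐ[ℂ] image q c := (toSkewLaurent q c).rangeRestrict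

/-- `R_c`, as an `R_c`-submodule of `B` (under left multiplication). -/
def imageSubmodule (q : ℂˣ) (c : ℂ) : Submodule (image q c) (SkewLaurent (q ^ 2)) where
  carrier := image q c
  add_mem' := add_mem
  zero_mem' := zero_mem _
  smul_mem' r _ hb := mul_mem r.2 hb

/-- The `R_c`-module `(R_c + Bα) / Bα`, as a submodule of `B / Bα`, where
`Bα = Ideal.span {α}` is the left ideal generated by `α`. -/
def cyclicModule (q : ℂˣ) (c : ℂ) (α : SkewLaurent (q ^ 2)) :
    Submodule (image q c) (SkewLaurent (q ^ 2) ⧸ Ideal.span {α}) :=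
  (imageSubmodule q c ⊔
      (Ideal.span {α}).restrictScalars (image q c)).map
    ((Ideal.span {α}).mkQ.restrictScalars (image q c))

/-! ### Weight modules over `U_c` -/

section Modules

variable (q : ℂˣ) (c : ℂ) (V : Type*) [AddCommGroup V] [Module ℂ V] [Module (Uc q c) V]
  [IsScalarTower ℂ (Uc q c) V]

/-- The weight space `{v ∈ V | K v = μ v}`. -/
def weightSpace (μ : ℂ) : Submodule ℂ V :=
  Module.End.eigenspace (Algebra.lsmul ℂ ℂ V (gen q c .K)) μ

/-- `V` is a highest weight module: it is generated by a nonzero weight vector that is killed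
by `E`. -/
def IsHighestWeight : Prop :=
  ∃ (μ : ℂ) (v : V), v ≠ 0 ∧ v ∈ weightSpace q c V μ ∧ gen q c .E • v = 0 ∧
    Submodule.span (Uc q c) {v} = ⊤

/-- `V` is a lowest weight module: it is generated by a nonzero weight vector that is killed
by `F`. -/
def IsLowestWeight : Prop :=
  ∃ (μ : ℂ) (v : V), v ≠ 0 ∧ v ∈ weightSpace q c V μ ∧ gen q c .F • v = 0 ∧
    Submodule.span (Uc q c) {v} = ⊤

/-- `V` is a module of the intermediate series: it is a weight module (the sum of its weight
spaces), its weights form a full coset `μ q^{2ℤ}` with `μ ≠ 0`, and all its nonzero weight spaces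
are one-dimensional. -/
def IsIntermediateSeries : Prop :=
  ∃ μ : ℂ, μ ≠ 0 ∧
    (∀ i : ℤ, Module.finrank ℂ (weightSpace q c V (μ * (q : ℂ) ^ (2 * i))) = 1) ∧
    ⨆ i : ℤ, weightSpace q c V (μ * (q : ℂ) ^ (2 * i)) = ⊤

end Modules

end Uc

end

/-! The simple module V is sorted by whether ℂ[K] acts on it with torsion.

Suppose a nonzero polynomial in K kills a nonzero vector. Splitting off roots over ℂ produces a
weight vector v (`Uc.exists_mem_weightSpace`). Since U_c is spanned by the products of a power of K
with a power of F or of E (`Uc.span_monomials`), V is spanned by the vectors Fⁿv and Eⁿv. If neither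
E nor F kills a nonzero weight vector, all of these are nonzero, and their weights are distinct
because q is not a root of unity. This is the intermediate series (`Uc.isWeightModule`).

Suppose ℂ[K] acts without torsion, and write V = U_c/I with I a maximal left ideal. B is the
localization of R_c at the nonzero polynomials in x (`Uc.exists_denominator`), and torsion-freeness
says that I is the contraction of its localization. Division by length makes left ideals of B
principal (`SkewLaurent.exists_eq_span_singleton`), and clearing denominators puts a generator α of
the localized ideal into R_c. Hence V ≅ R_c/(R_c ∩ Bα) ≅ (R_c + Bα)/Bα. Maximality of I makes α
irreducible, and α ≠ 0 because the zero ideal of U_c is not maximal (`Uc.ne_bot_of_isMaximal`).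

Both injectivity claims hold because spanning monomials go to elements xⁱ pⱼ(x) yʲ with pⱼ ≠ 0.
These are linearly independent, since the xⁱ are eigenvectors of f(x) ↦ f(νx) with distinct
eigenvalues. -/

noncomputable section

/-! ### The ring B: coefficients, absence of zero divisors, principal left ideals. -/

namespace SkewLaurent

variable {ν : ℂˣ}

open TwistedRatFunc (scale)

/-- The coefficient of `yⁿ` in an element of `B`. -/
def coeffAt (ν : ℂˣ) (n : ℤ) : SkewLaurent ν →ₗ[ℂ] TwistedRatFunc ν where
  toFun b := SkewMonoidAlgebra.coeff (k := TwistedRatFunc ν) (G := Multiplicative ℤ) b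
    (Multiplicative.ofAdd n)
  map_add' a b := DFunLike.congr_fun (SkewMonoidAlgebra.coeff_add (k := TwistedRatFunc ν)
    (G := Multiplicative ℤ) a b) (Multiplicative.ofAdd n)
  map_smul' r a := DFunLike.congr_fun (SkewMonoidAlgebra.coeff_smul (k := TwistedRatFunc ν)
    (G := Multiplicative ℤ) r a) (Multiplicative.ofAdd n)

theorem coeffAt_apply (n : ℤ) (b : SkewLaurent ν) :
    coeffAt ν n b = SkewMonoidAlgebra.coeff (k := TwistedRatFunc ν) (G := Multiplicative ℤ) b
      (Multiplicative.ofAdd n) := rfl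

theorem ext_coeffAt {a b : SkewLaurent ν} (h : ∀ n, coeffAt ν n a = coeffAt ν n b) : a = b :=
  SkewMonoidAlgebra.ext (k := TwistedRatFunc ν) (G := Multiplicative ℤ)
    fun n => h (Multiplicative.toAdd n)

theorem coeffAt_mono (f : TwistedRatFunc ν) (m n : ℤ) :
    coeffAt ν n (mono ν f m) = if m = n then f else 0 := by
  classical
  rw [coeffAt_apply]
  unfold mono
  rw [SkewMonoidAlgebra.coeff_single_apply]
  exact if_congr Multiplicative.ofAdd.injective.eq_iff rfl rfl

theorem mono_add (f g : TwistedRatFunc ν) (n : ℤ) :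
    mono ν (f + g) n = mono ν f n + mono ν g n :=
  SkewMonoidAlgebra.single_add _ _ _

theorem induction_mono {p : SkewLaurent ν → Prop} (b : SkewLaurent ν) (zero : p 0)
    (mono : ∀ f n, p (mono ν f n)) (add : ∀ a b, p a → p b → p (a + b)) : p b :=
  SkewMonoidAlgebra.induction_on (k := TwistedRatFunc ν) (G := Multiplicative ℤ) b zero
    (fun g f => mono f (Multiplicative.toAdd g)) (fun {a b} => add a b)

theorem coeffAt_mono_mul (f : TwistedRatFunc ν) (m n : ℤ) (b : SkewLaurent ν) :
    coeffAt ν n (mono ν f m * b) = f * (scale ν ^ m) (coeffAt ν (n - m) b) := by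
  induction b using induction_mono with
  | zero => simp
  | mono g k =>
    rw [mono_mul_mono, coeffAt_mono, coeffAt_mono]
    by_cases h : k = n - m
    · rw [if_pos h, if_pos (by omega)]
    · rw [if_neg h, if_neg (by omega), map_zero, mul_zero]
  | add a b ha hb => rw [mul_add, map_add, ha, hb, map_add, map_add, mul_add]

theorem finite_support (b : SkewLaurent ν) : {n | coeffAt ν n b ≠ 0}.Finite := by
  induction b using induction_mono with
  | zero => simp
  | mono g k =>
    refine (Set.finite_singleton k).subset fun n hn => ?_
    by_contra h
    exact hn (by rw [coeffAt_mono, if_neg (fun e => h e.symm)])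
  | add a b ha hb =>
    refine (ha.union hb).subset fun n hn => ?_
    by_contra h
    simp only [Set.mem_union, Set.mem_ofPred_eq, not_or, not_not] at h
    exact hn (by rw [map_add, h.1, h.2, add_zero])

theorem eq_sum_mono (b : SkewLaurent ν) :
    b = ∑ k ∈ (finite_support b).toFinset, mono ν (coeffAt ν k b) k := by
  refine ext_coeffAt fun n => ?_
  simp only [map_sum, coeffAt_mono, Finset.sum_ite_eq']
  by_cases h : coeffAt ν n b = 0 <;> simp [h]

theorem coeffAt_mul (a b : SkewLaurent ν) (n : ℤ) :
    coeffAt ν n (a * b) = ∑ k ∈ (finite_support a).toFinset,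
      coeffAt ν k a * (scale ν ^ k) (coeffAt ν (n - k) b) := by
  conv_lhs => rw [eq_sum_mono a]
  simp only [Finset.sum_mul, map_sum, coeffAt_mono_mul]

theorem exists_top {b : SkewLaurent ν} (hb : b ≠ 0) :
    ∃ n, coeffAt ν n b ≠ 0 ∧ ∀ k, coeffAt ν k b ≠ 0 → k ≤ n := by
  have hne : (finite_support b).toFinset.Nonempty := by
    by_contra h
    rw [Finset.not_nonempty_iff_eq_empty] at h
    exact hb ((eq_sum_mono b).trans (by rw [h, Finset.sum_empty]))
  have hm := Finset.max'_mem _ hne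
  refine ⟨_, by simpa using hm, fun k hk => Finset.le_max' _ k ?_⟩
  simpa using hk

/-- If m and n are the top exponents of a and b, only one term contributes to the coefficient of
yᵐ⁺ⁿ in ab, namely a_m(x) b_n(νᵐx), which is nonzero. -/
instance : NoZeroDivisors (SkewLaurent ν) where
  eq_zero_or_eq_zero_of_mul_eq_zero {a b} h := by
    by_contra! hab
    obtain ⟨m, hm, hm'⟩ := exists_top hab.1
    obtain ⟨n, hn, hn'⟩ := exists_top hab.2
    have h0 : coeffAt ν (m + n) (a * b) = 0 := by rw [h, map_zero]
    rw [coeffAt_mul, Finset.sum_eq_single m] at h0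
    · rw [add_sub_cancel_left, mul_eq_zero] at h0
      exact h0.elim hm fun h => hn (by simpa using h)
    · intro k hk hkm
      have hk' := hm' k (by simpa using hk)
      have : coeffAt ν (m + n - k) b = 0 := by
        by_contra h
        have := hn' _ h
        omega
      rw [this, map_zero, mul_zero]
    · intro h
      simp only [Set.Finite.mem_toFinset, Set.mem_ofPred_eq, not_not] at h
      rw [h, zero_mul]

instance : Nontrivial (SkewLaurent ν) :=
  inferInstanceAs (Nontrivial (SkewMonoidAlgebra (TwistedRatFunc ν) (Multiplicative ℤ)))

/-- In a domain (ba − 1)b = 0 makes a one-sided inverse two-sided. Membership in a left ideal Bb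
only ever yields one-sided inverses. -/
theorem isUnit_of_mul_eq_one_left {a b : SkewLaurent ν} (h : a * b = 1) : IsUnit b := by
  have hb : b ≠ 0 := by
    rintro rfl
    simp at h
  have h' : b * a = 1 := by
    have : (b * a - 1) * b = 0 := by rw [sub_mul, mul_assoc, h, mul_one, one_mul, sub_self]
    exact sub_eq_zero.1 ((mul_eq_zero.1 this).resolve_right hb)
  exact ⟨⟨b, a, h', h⟩, rfl⟩

theorem isUnit_mono {f : TwistedRatFunc ν} (hf : f ≠ 0) : IsUnit (mono ν f 0) := by
  refine ⟨⟨mono ν f 0, mono ν f⁻¹ 0, ?_, ?_⟩, rfl⟩ <;>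
    simp [mono_mul_mono, one_eq_mono, hf]

/-- All exponents of `b` lie in an interval of `n` consecutive integers. -/
def HasLength (b : SkewLaurent ν) (n : ℕ) : Prop :=
  ∃ m : ℤ, ∀ k, coeffAt ν k b ≠ 0 → m ≤ k ∧ k < m + n

theorem exists_hasLength (b : SkewLaurent ν) : ∃ n, HasLength b n := by
  obtain ⟨l, hl⟩ := (finite_support b).bddBelow
  obtain ⟨u, hu⟩ := (finite_support b).bddAbove
  refine ⟨(u - l + 1).toNat, l, fun k hk => ⟨hl hk, ?_⟩⟩
  have := hl hk
  have := hu hk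
  omega

theorem HasLength.eq_zero {b : SkewLaurent ν} (h : HasLength b 0) : b = 0 := by
  obtain ⟨m, hm⟩ := h
  refine ext_coeffAt fun k => ?_
  by_contra hk
  have := hm k (by simpa using hk)
  omega

/-- Left ideals of `B` are principal. -/
theorem exists_eq_span_singleton (J : Ideal (SkewLaurent ν)) : ∃ a, J = Ideal.span {a} := by
  classical
  by_cases hJ : J = ⊥
  · exact ⟨0, by rw [hJ, Ideal.span_singleton_zero]⟩
  obtain ⟨a₀, ha₀, hne⟩ := Submodule.exists_mem_ne_zero_of_ne_bot hJ
  have hex : ∃ n, ∃ a ∈ J, a ≠ 0 ∧ HasLength a n :=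
    (exists_hasLength a₀).imp fun n hn => ⟨a₀, ha₀, hne, hn⟩
  -- Choose a nonzero element of J of minimal length. Length replaces degree because y is
  -- invertible, so shifting all exponents costs nothing.
  obtain ⟨a, ha, ha0, m, hm⟩ := Nat.find_spec hex
  have hmin : ∀ l, l < Nat.find hex → ∀ b ∈ J, HasLength b l → b = 0 := fun l hl b hb hbl => by
    by_contra h
    exact Nat.find_min hex hl ⟨b, hb, h, hbl⟩
  generalize Nat.find hex = N at hm hmin
  have hN : 0 < N := by
    rcases Nat.eq_zero_or_pos N with rfl | h
    · exact absurd (HasLength.eq_zero ⟨m, hm⟩) ha0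
    · exact h
  -- `t` is the last exponent allowed by the interval; by minimality of `N` the coefficient there
  -- cannot vanish.
  set t : ℤ := m + N - 1 with ht
  have htop : coeffAt ν t a ≠ 0 := fun h => ha0 <| hmin (N - 1) (by omega) a ha
    ⟨m, fun k hk => ⟨(hm k hk).1, by
      have := (hm k hk).2
      have : k ≠ t := by
        rintro rfl
        exact hk h
      omega⟩⟩
  refine ⟨a, le_antisymm ?_ ((Ideal.span_singleton_le_iff_mem _).2 ha)⟩
  have key : ∀ n, ∀ b ∈ J, HasLength b n → b ∈ Ideal.span {a} := by
    intro n
    induction n with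
    | zero =>
      intro b _ hb
      rw [hb.eq_zero]
      exact zero_mem _
    | succ n ih =>
      intro b hb hbn
      by_cases hn : n + 1 < N
      · rw [hmin _ hn b hb hbn]
        exact zero_mem _
      obtain ⟨l, hl⟩ := hbn
      -- Division step: the shift `s` moves the top exponent `t` of `a` to that of `b`, and `f` is
      -- chosen so that subtracting `f yˢ a` cancels the top coefficient of `b`. The twist `scale ν
      -- ^ s` comes from moving yˢ past the coefficient.
      set s : ℤ := l + n - t with hs
      set f : TwistedRatFunc ν := coeffAt ν (l + n) b * ((scale ν ^ s) (coeffAt ν t a))⁻¹ with hf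
      have hmem : mono ν f s * a ∈ Ideal.span {a} :=
        Ideal.mul_mem_left _ _ (Ideal.mem_span_singleton_self a)
      have hmemJ : mono ν f s * a ∈ J := Ideal.mul_mem_left _ _ ha
      rw [← sub_add_cancel b (mono ν f s * a)]
      refine add_mem (ih _ (sub_mem hb hmemJ) ⟨l, fun k hk => ?_⟩) hmem
      rw [map_sub, coeffAt_mono_mul] at hk
      have hk1 : k ≠ l + n := by
        rintro rfl
        apply hk
        have : l + n - s = t := by omega
        rw [this, hf, inv_mul_cancel_right₀, sub_self]
        simpa using htop
      by_cases hb' : coeffAt ν k b = 0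
      · have : coeffAt ν (k - s) a ≠ 0 := by
          intro h
          rw [hb', h, map_zero, mul_zero, sub_zero] at hk
          exact hk rfl
        have := hm _ this
        push_cast at *
        omega
      · have := hl k hb'
        push_cast at *
        omega
  intro b hb
  obtain ⟨n, hn⟩ := exists_hasLength b
  exact key n b hb hn

/-- The element `1 + y` has no left inverse. -/
theorem mul_one_add_y_ne_one (a : SkewLaurent ν) : a * (1 + mono ν 1 1) ≠ 1 := by
  -- Evaluation at y = −1 with coefficients on the left. It is not multiplicative, but right
  -- multiplication by y only changes its sign, so it kills every left multiple of 1 + y, whereas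
  -- its value at 1 is 1.
  let F : SkewLaurent ν →+ TwistedRatFunc ν :=
    { toFun := fun b => ∑ᶠ n : ℤ, (-1) ^ n * coeffAt ν n b
      map_zero' := by simp
      map_add' := fun b b' => by
        simp only [map_add, mul_add]
        refine finsum_add_distrib ?_ ?_
        · exact (finite_support b).subset fun n hn h => hn (by simp [h])
        · exact (finite_support b').subset fun n hn h => hn (by simp [h]) }
  have hF : ∀ f n, F (mono ν f n) = (-1) ^ n * f := by
    intro f n
    refine (finsum_eq_single _ n fun k hk => ?_).trans ?_
    · rw [coeffAt_mono, if_neg hk.symm, mul_zero]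
    · rw [coeffAt_mono, if_pos rfl]
  have h0 : F (a * (1 + mono ν 1 1)) = 0 := by
    induction a using induction_mono with
    | zero => rw [zero_mul, map_zero]
    | mono f n =>
      rw [mul_add, mul_one, mono_mul_mono, map_add, hF, hF, map_one, mul_one,
        zpow_add_one₀ (by simp)]
      ring
    | add a b ha hb => rw [add_mul, map_add, ha, hb, add_zero]
  intro h
  rw [h, one_eq_mono, hF] at h0
  simp at h0

end SkewLaurent

/-! ### Tools for spanning sets, injectivity and twisted commutation. -/

/-- A linear subspace of an algebra that contains `1` and is stable under left multiplication by
a set of algebra generators is everything. -/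
theorem Submodule.eq_top_of_adjoin_eq_top {A : Type*} [Ring A] [Algebra ℂ A] {G : Set A}
    (hG : Algebra.adjoin ℂ G = ⊤) (S : Submodule ℂ A) (h1 : 1 ∈ S)
    (hS : ∀ g ∈ G, ∀ s ∈ S, g * s ∈ S) : S = ⊤ := by
  -- The elements whose left multiplication preserves `S` form a subalgebra, so it is enough to have
  -- the generators in it.
  let T : Subalgebra ℂ A :=
    { carrier := {a | ∀ s ∈ S, a * s ∈ S}
      mul_mem' := fun {a b} ha hb s hs => by rw [mul_assoc]; exact ha _ (hb _ hs)
      add_mem' := fun {a b} ha hb s hs => by rw [add_mul]; exact add_mem (ha _ hs) (hb _ hs)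
      algebraMap_mem' := fun r s hs => by
        rw [← Algebra.smul_def]; exact S.smul_mem _ hs }
  have hT : Algebra.adjoin ℂ G ≤ T := Algebra.adjoin_le hS
  rw [hG] at hT
  refine eq_top_iff.2 fun a _ => ?_
  have : a ∈ T := hT Algebra.mem_top
  simpa using this 1 h1

/-- A linear map that sends a spanning family to an independent one is injective. -/
theorem LinearMap.injective_of_span_of_linearIndependent {ι A B : Type*} [AddCommGroup A]
    [Module ℂ A] [AddCommGroup B] [Module ℂ B] (f : A →ₗ[ℂ] B) {w : ι → A}
    {v : ι → B} (hw : Submodule.span ℂ (Set.range w) = ⊤) (hv : LinearIndependent ℂ v)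
    (hf : ∀ i, f (w i) = v i) : Function.Injective f := by
  rw [injective_iff_map_eq_zero]
  intro a ha
  have : a ∈ Submodule.span ℂ (Set.range w) := hw ▸ Submodule.mem_top
  obtain ⟨l, rfl⟩ := (Finsupp.mem_span_range_iff_exists_finsupp).1 this
  have h : Finsupp.linearCombination ℂ v l = 0 := by
    rw [← ha, Finsupp.linearCombination_apply, map_finsuppSum]
    simp [hf]
  rw [linearIndependent_iff] at hv
  rw [hv l h, Finsupp.sum_zero_index]

/-- If `a u = r u a` with `u` invertible, then `a uⁱ = rⁱ uⁱ a` for all integers `i`. -/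
theorem mul_units_zpow_of_mul_eq_smul {A : Type*} [Ring A] [Algebra ℂ A] (r : ℂˣ) (u : Aˣ) (a : A)
    (h : a * u = (r : ℂ) • (u * a)) (i : ℤ) :
    a * ↑(u ^ i) = ((r : ℂ) ^ i) • (↑(u ^ i) * a) := by
  set r' : Aˣ := Units.map (algebraMap ℂ A) r with hr'
  have hr : ∀ b : A, (r' : A) * b = (r : ℂ) • b := fun b => (Algebra.smul_def _ _).symm
  have hc : Commute r' u := Units.ext (Algebra.commutes _ _)
  -- Read as a semiconjugation from `u` to `r' u`, the relation passes to integer powers, and the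
  -- central unit `r'` then splits off.
  have hs : SemiconjBy a (u : A) ((r' * u : Aˣ) : A) := by
    rw [SemiconjBy, h, Units.val_mul, mul_assoc, hr]
  have := hs.units_zpow_right i
  rw [SemiconjBy, hc.mul_zpow, Units.val_mul, mul_assoc] at this
  rw [this, hr', ← map_zpow, Units.coe_map, ← Units.val_zpow_eq_zpow_val]
  exact (Algebra.smul_def _ _).symm

/-! ### Linear independence of monomials in B. -/

namespace TwistedRatFunc

theorem scale_zpow_X (ν : ℂˣ) (i : ℤ) : scale ν (X ν ^ i) = ((ν : ℂ) ^ i) • X ν ^ i := by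
  rw [map_zpow₀, scale_X, Algebra.smul_def, Algebra.smul_def, mul_zpow, map_zpow₀]

/-- The powers of `x` are linearly independent, being eigenvectors of the scaling. -/
theorem linearIndependent_zpow_X {ν : ℂˣ} (hν : Function.Injective fun i : ℤ => (ν : ℂ) ^ i) :
    LinearIndependent ℂ fun i : ℤ => X ν ^ i :=
  Module.End.eigenvectors_linearIndependent' (scale ν).toLinearMap (fun i : ℤ => (ν : ℂ) ^ i)
    hν _ fun i => ⟨Module.End.mem_eigenspace_iff.2 (scale_zpow_X ν i),
      zpow_ne_zero _ (X_ne_zero ν)⟩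

end TwistedRatFunc

namespace SkewLaurent

variable {ν : ℂˣ}

/-- The inclusion `ℂ(x) → B`. -/
def ofRatFunc (ν : ℂˣ) : TwistedRatFunc ν →ₐ[ℂ] SkewLaurent ν :=
  AlgHom.ofLinearMap
    { toFun := fun f => mono ν f 0
      map_add' := fun f g => mono_add f g 0
      map_smul' := fun a f => (smul_mono ν a f 0).symm }
    rfl fun f g => by
      change mono ν (f * g) 0 = mono ν f 0 * mono ν g 0
      rw [mono_mul_mono]
      simp

theorem ofRatFunc_apply (f : TwistedRatFunc ν) : ofRatFunc ν f = mono ν f 0 := rfl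

theorem aeval_mono_X (s : Polynomial ℂ) : Polynomial.aeval (mono ν (TwistedRatFunc.X ν) 0) s =
    mono ν (algebraMap (Polynomial ℂ) (TwistedRatFunc ν) s) 0 := by
  rw [← ofRatFunc_apply, Polynomial.aeval_algHom_apply, ← ofRatFunc_apply]
  congr 1
  unfold TwistedRatFunc.X
  rw [Polynomial.aeval_algebraMap_apply, Polynomial.aeval_X_left_apply]

theorem map_units_zpow_eq_mono {A : Type*} [Ring A] [Algebra ℂ A] (f : A →ₐ[ℂ] SkewLaurent ν)
    (u : Aˣ) (hu : f u = mono ν (TwistedRatFunc.X ν) 0) (i : ℤ) :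
    f ↑(u ^ i) = mono ν (TwistedRatFunc.X ν ^ i) 0 := by
  let v : (TwistedRatFunc ν)ˣ := Units.mk0 _ (TwistedRatFunc.X_ne_zero ν)
  have h : Units.map (f : A →* SkewLaurent ν) u =
      Units.map (ofRatFunc ν : TwistedRatFunc ν →* SkewLaurent ν) v := Units.ext hu
  have h2 := congrArg (fun w => ((w ^ i : (SkewLaurent ν)ˣ) : SkewLaurent ν)) h
  simp only [← map_zpow] at h2
  refine h2.trans ?_
  change mono ν _ 0 = _
  rw [Units.val_zpow_eq_zpow_val]
  rfl

/-- Different powers of y lie in different summands, and for a fixed power multiplication by `p j`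
is injective on ℂ(x). The quantum torus needs only `p = 1`; the factors `p j` are needed for U_c,
where Eⁿ does not map to a pure power of y. -/
theorem linearIndependent_mono (hν : Function.Injective fun i : ℤ => (ν : ℂ) ^ i)
    {p : ℤ → TwistedRatFunc ν} (hp : ∀ j, p j ≠ 0) :
    LinearIndependent ℂ fun x : Σ _ : ℤ, ℤ =>
      mono ν (TwistedRatFunc.X ν ^ x.2 * p x.1) x.1 := by
  let L : SkewLaurent ν →ₗ[ℂ] (ℤ →₀ TwistedRatFunc ν) :=
    { toFun := fun b => Finsupp.ofSupportFinite (fun n => coeffAt ν n b) (finite_support b)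
      map_add' := fun a b => Finsupp.ext fun n => map_add (coeffAt ν n) a b
      map_smul' := fun r a => Finsupp.ext fun n => map_smul (coeffAt ν n) r a }
  have hL : ∀ f n, L (mono ν f n) = Finsupp.single n f := fun f n => by
    classical
    refine Finsupp.ext fun k => ?_
    rw [Finsupp.single_apply]
    exact coeffAt_mono f n k
  refine LinearIndependent.of_comp L ?_
  have h := Finsupp.linearIndependent_single (R := ℂ)
    (fun j i : ℤ => TwistedRatFunc.X ν ^ i * p j) fun j => by
      have := (TwistedRatFunc.linearIndependent_zpow_X hν).map_injOn
        (LinearMap.mulRight ℂ (p j)) (mul_left_injective₀ (hp j)).injOn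
      exact this
  convert h using 2 with x
  exact hL _ _

end SkewLaurent

/-! ### The quantum torus embeds in B. -/

namespace QTorus

theorem adjoin_range_gen (ν : ℂˣ) : Algebra.adjoin ℂ (Set.range (gen ν)) = ⊤ := by
  have h := congrArg (Subalgebra.map (RingQuot.mkAlgHom ℂ (TorusRel ν)))
    (FreeAlgebra.adjoin_range_ι ℂ TorusGen)
  rw [AlgHom.map_adjoin, ← Set.range_comp, Algebra.map_top,
    (AlgHom.range_eq_top _).2 (RingQuot.mkAlgHom_surjective ℂ _)] at h
  exact h

/-- `x` as a unit of the quantum torus. -/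
def xUnit (ν : ℂˣ) : (QTorus ν)ˣ := ⟨gen ν .x, gen ν .xinv, x_mul_xinv ν, xinv_mul_x ν⟩

/-- `y` as a unit of the quantum torus. -/
def yUnit (ν : ℂˣ) : (QTorus ν)ˣ := ⟨gen ν .y, gen ν .yinv, y_mul_yinv ν, yinv_mul_y ν⟩

theorem yUnit_zpow_mul_xUnit_zpow (ν : ℂˣ) (j i : ℤ) :
    ((yUnit ν ^ j : (QTorus ν)ˣ) : QTorus ν) * ↑(xUnit ν ^ i) =
      (((ν ^ j : ℂˣ) : ℂ) ^ i) • (↑(xUnit ν ^ i) * ↑(yUnit ν ^ j)) := by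
  refine mul_units_zpow_of_mul_eq_smul _ _ _ ?_ i
  -- Twisted commutation is used twice: here x is moved past yʲ, after which yʲ is moved past xⁱ.
  have h : (gen ν .x) * (yUnit ν : QTorus ν) = ((ν⁻¹ : ℂˣ) : ℂ) • (yUnit ν * gen ν .x) := by
    change gen ν .x * gen ν .y = _ • (gen ν .y * gen ν .x)
    rw [y_mul_x, smul_smul, Units.inv_mul, one_smul]
  have := mul_units_zpow_of_mul_eq_smul _ _ _ h j
  change _ * gen ν .x = _ • (gen ν .x * _)
  rw [this, smul_smul, ← Units.val_zpow_eq_zpow_val, ← Units.val_mul, ← mul_zpow,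
    mul_inv_cancel, one_zpow, Units.val_one, one_smul]

/-- The span of the ordered monomials is stable under left multiplication by the generators: x^{±1}
shifts an exponent, and y^{±1} passes the powers of x at the cost of a scalar. -/
theorem span_monomials (ν : ℂˣ) : Submodule.span ℂ (Set.range fun x : Σ _ : ℤ, ℤ =>
    ((xUnit ν ^ x.2 : (QTorus ν)ˣ) : QTorus ν) * ↑(yUnit ν ^ x.1)) = ⊤ := by
  have hmem : ∀ i j : ℤ, ((xUnit ν ^ i : (QTorus ν)ˣ) : QTorus ν) * ↑(yUnit ν ^ j) ∈
      Submodule.span ℂ (Set.range fun x : Σ _ : ℤ, ℤ =>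
        ((xUnit ν ^ x.2 : (QTorus ν)ˣ) : QTorus ν) * ↑(yUnit ν ^ x.1)) :=
    fun i j => Submodule.subset_span ⟨⟨j, i⟩, rfl⟩
  refine Submodule.eq_top_of_adjoin_eq_top (adjoin_range_gen ν) _ (by simpa using hmem 0 0) ?_
  have hx : ∀ k i j : ℤ, ((xUnit ν ^ k : (QTorus ν)ˣ) : QTorus ν) *
      (((xUnit ν ^ i : (QTorus ν)ˣ) : QTorus ν) * ↑(yUnit ν ^ j)) ∈ _ := fun k i j => by
    have := hmem (k + i) j
    rwa [zpow_add, Units.val_mul, mul_assoc] at this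
  have hy : ∀ k i j : ℤ, ((yUnit ν ^ k : (QTorus ν)ˣ) : QTorus ν) *
      (((xUnit ν ^ i : (QTorus ν)ˣ) : QTorus ν) * ↑(yUnit ν ^ j)) ∈ _ := fun k i j => by
    have := hmem i (k + j)
    rw [zpow_add, Units.val_mul] at this
    rw [← mul_assoc, yUnit_zpow_mul_xUnit_zpow, smul_mul_assoc, mul_assoc]
    exact Submodule.smul_mem _ _ this
  rintro _ ⟨g, rfl⟩ s hs
  induction hs using Submodule.span_induction with
  | mem s hs =>
    obtain ⟨⟨j, i⟩, rfl⟩ := hs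
    cases g
    · have := hx 1 i j
      rwa [zpow_one] at this
    · have := hx (-1) i j
      rwa [zpow_neg_one] at this
    · have := hy 1 i j
      rwa [zpow_one] at this
    · have := hy (-1) i j
      rwa [zpow_neg_one] at this
  | zero => simp
  | add a b _ _ ha hb => rw [mul_add]; exact add_mem ha hb
  | smul r a _ ha => rw [mul_smul_comm]; exact Submodule.smul_mem _ _ ha

theorem toSkewLaurent_gen (ν : ℂˣ) (g : TorusGen) :
    toSkewLaurent ν (gen ν g) = SkewLaurent.torusGen ν g := lift_gen _ _ _ _

theorem toSkewLaurent_yUnit_zpow (ν : ℂˣ) (j : ℤ) :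
    toSkewLaurent ν ↑(yUnit ν ^ j) = SkewLaurent.mono ν 1 j := by
  let h : Multiplicative ℤ →* SkewLaurent ν :=
    { toFun := fun n => SkewLaurent.mono ν 1 n.toAdd
      map_one' := rfl
      map_mul' := fun m n => by
        rw [SkewLaurent.mono_mul_mono, map_one, mul_one, toAdd_mul] }
  have e : Units.map (toSkewLaurent ν : QTorus ν →* SkewLaurent ν) (yUnit ν) =
      h.toHomUnits (Multiplicative.ofAdd 1) := Units.ext (toSkewLaurent_gen ν .y)
  have e2 := congrArg (fun w => ((w ^ j : (SkewLaurent ν)ˣ) : SkewLaurent ν)) e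
  simp only [← map_zpow] at e2
  refine e2.trans ?_
  change SkewLaurent.mono ν 1 _ = _
  simp

theorem toSkewLaurent_injective {ν : ℂˣ} (hν : Function.Injective fun i : ℤ => (ν : ℂ) ^ i) :
    Function.Injective (toSkewLaurent ν) := by
  refine LinearMap.injective_of_span_of_linearIndependent (toSkewLaurent ν).toLinearMap
    (span_monomials ν)
    (SkewLaurent.linearIndependent_mono hν (p := fun _ => 1) fun _ => one_ne_zero) fun x => ?_
  simp only [AlgHom.toLinearMap_apply, map_mul, toSkewLaurent_yUnit_zpow]
  rw [SkewLaurent.map_units_zpow_eq_mono _ _ (toSkewLaurent_gen ν .x),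
    SkewLaurent.mono_mul_mono]
  simp

end QTorus

/-! ### Relations and spanning monomials of U_c. -/

theorem pow_mul_of_mul_eq_smul {A : Type*} [Ring A] [Algebra ℂ A] {r : ℂ} {u a : A}
    (h : a * u = r • (u * a)) (n : ℕ) : a ^ n * u = r ^ n • (u * a ^ n) := by
  induction n with
  | zero => simp
  | succ n ih =>
    rw [pow_succ, mul_assoc, h, mul_smul_comm, ← mul_assoc, ih, smul_mul_assoc, smul_smul,
      mul_assoc, pow_succ, mul_comm]

theorem Uq.adjoin_range_gen (q : ℂˣ) : Algebra.adjoin ℂ (Set.range (Uq.gen q)) = ⊤ := by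
  have h := congrArg (Subalgebra.map (RingQuot.mkAlgHom ℂ (UqRel q)))
    (FreeAlgebra.adjoin_range_ι ℂ UqGen)
  rw [AlgHom.map_adjoin, ← Set.range_comp, Algebra.map_top,
    (AlgHom.range_eq_top _).2 (RingQuot.mkAlgHom_surjective ℂ _)] at h
  exact h

namespace Uc

variable (q : ℂˣ) (c : ℂ)

theorem adjoin_range_gen : Algebra.adjoin ℂ (Set.range (gen q c)) = ⊤ := by
  have h := congrArg (Subalgebra.map (mk q c)) (Uq.adjoin_range_gen q)
  rw [AlgHom.map_adjoin, ← Set.range_comp, Algebra.map_top, (AlgHom.range_eq_top _).2] at h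
  · exact h
  · exact RingQuot.mkAlgHom_surjective ℂ _

theorem mk_rel {a b : FreeAlgebra ℂ UqGen} (h : UqRel q a b) :
    mk q c (RingQuot.mkAlgHom ℂ (UqRel q) a) = mk q c (RingQuot.mkAlgHom ℂ (UqRel q) b) :=
  congrArg (mk q c) (RingQuot.mkAlgHom_rel ℂ h)

/-- The quotient map from the free algebra. -/
def ofFree : FreeAlgebra ℂ UqGen →ₐ[ℂ] Uc q c :=
  (mk q c).comp (show FreeAlgebra ℂ UqGen →ₐ[ℂ] Uq q from RingQuot.mkAlgHom ℂ (UqRel q))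

theorem ofFree_rel {a b : FreeAlgebra ℂ UqGen} (h : UqRel q a b) :
    ofFree q c a = ofFree q c b := mk_rel q c h

theorem ofFree_free (g : UqGen) : ofFree q c g.free = gen q c g := rfl

theorem K_mul_Kinv : gen q c .K * gen q c .Kinv = 1 := by
  simpa only [map_mul, map_one, ofFree_free] using ofFree_rel q c .K_mul_Kinv

theorem Kinv_mul_K : gen q c .Kinv * gen q c .K = 1 := by
  simpa only [map_mul, map_one, ofFree_free] using ofFree_rel q c .Kinv_mul_K

theorem K_mul_E : gen q c .K * gen q c .E = ((q : ℂ) ^ 2) • (gen q c .E * gen q c .K) := by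
  have h := ofFree_rel q c .K_E
  simp only [map_mul, map_smul, ofFree_free] at h
  rw [← smul_mul_assoc, ← h, mul_assoc _ _ (gen q c .K), Kinv_mul_K, mul_one]

theorem E_mul_K :
    gen q c .E * gen q c .K = (((q ^ 2)⁻¹ : ℂˣ) : ℂ) • (gen q c .K * gen q c .E) := by
  rw [K_mul_E, smul_smul, ← Units.val_pow_eq_pow_val, Units.inv_mul, one_smul]

theorem F_mul_K :
    gen q c .F * gen q c .K = ((q ^ 2 : ℂˣ) : ℂ) • (gen q c .K * gen q c .F) := by
  have h := ofFree_rel q c .K_F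
  simp only [map_mul, map_smul, ofFree_free] at h
  have h2 : gen q c .K * gen q c .F = ((q : ℂ) ^ 2)⁻¹ • (gen q c .F * gen q c .K) := by
    rw [← smul_mul_assoc, ← h, mul_assoc _ _ (gen q c .K), Kinv_mul_K, mul_one]
  rw [h2, smul_smul, Units.val_pow_eq_pow_val, mul_inv_cancel₀ (pow_ne_zero 2 q.ne_zero),
    one_smul]

/-- Fixing the Casimir makes EF, and then FE, a Laurent polynomial in K. This is why mixed products
of E and F are not needed to span U_c. -/
theorem E_mul_F : gen q c .E * gen q c .F = c • (1 : Uc q c) - (((q : ℂ) - (q : ℂ)⁻¹) ^ 2)⁻¹ •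
    ((q : ℂ)⁻¹ • gen q c .K + (q : ℂ) • gen q c .Kinv) := by
  have h : mk q c (Uq.casimir q) = mk q c (algebraMap ℂ (Uq q) c) :=
    RingQuot.mkAlgHom_rel ℂ UcRel.casimir
  rw [AlgHom.commutes, Algebra.algebraMap_eq_smul_one] at h
  rw [← h, Uq.casimir]
  simp only [map_add, map_mul, map_smul, gen]
  abel

theorem F_mul_E : gen q c .F * gen q c .E = gen q c .E * gen q c .F -
    ((q : ℂ) - (q : ℂ)⁻¹)⁻¹ • (gen q c .K - gen q c .Kinv) := by
  have h := ofFree_rel q c .E_F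
  simp only [map_mul, map_smul, map_sub, ofFree_free] at h
  rw [← h, sub_sub_cancel]

/-- `K` as a unit of `U_c`. -/
def KUnit : (Uc q c)ˣ := ⟨gen q c .K, gen q c .Kinv, K_mul_Kinv q c, Kinv_mul_K q c⟩

/-- The powers of `K`, spanning the Cartan part of `U_c`. -/
def cartan : Submodule ℂ (Uc q c) :=
  Submodule.span ℂ (Set.range fun i : ℤ => ((KUnit q c ^ i : (Uc q c)ˣ) : Uc q c))

theorem KUnit_zpow_mem_cartan (i : ℤ) : ((KUnit q c ^ i : (Uc q c)ˣ) : Uc q c) ∈ cartan q c :=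
  Submodule.subset_span ⟨i, rfl⟩

theorem one_mem_cartan : 1 ∈ cartan q c := by simpa using KUnit_zpow_mem_cartan q c 0

theorem K_mem_cartan : gen q c .K ∈ cartan q c := by
  have := KUnit_zpow_mem_cartan q c 1
  rwa [zpow_one] at this

theorem Kinv_mem_cartan : gen q c .Kinv ∈ cartan q c := by
  have := KUnit_zpow_mem_cartan q c (-1)
  rwa [zpow_neg_one] at this

theorem E_mul_F_mem_cartan : gen q c .E * gen q c .F ∈ cartan q c := by
  rw [E_mul_F]
  exact sub_mem (Submodule.smul_mem _ _ (one_mem_cartan q c)) (Submodule.smul_mem _ _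
    (add_mem (Submodule.smul_mem _ _ (K_mem_cartan q c))
      (Submodule.smul_mem _ _ (Kinv_mem_cartan q c))))

theorem F_mul_E_mem_cartan : gen q c .F * gen q c .E ∈ cartan q c := by
  rw [F_mul_E]
  exact sub_mem (E_mul_F_mem_cartan q c) (Submodule.smul_mem _ _
    (sub_mem (K_mem_cartan q c) (Kinv_mem_cartan q c)))

/-- The elements `Fʲ` for `j ≥ 0` and `E⁻ʲ` for `j < 0`. -/
def ladder : ℤ → Uc q c
  | Int.ofNat n => gen q c .F ^ n
  | Int.negSucc n => gen q c .E ^ (n + 1)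

theorem ladder_natCast (n : ℕ) : ladder q c n = gen q c .F ^ n := rfl

theorem ladder_neg_natCast (n : ℕ) : ladder q c (-(n : ℤ)) = gen q c .E ^ n := by
  cases n with
  | zero =>
    rw [Nat.cast_zero, neg_zero]
    exact (ladder_natCast q c 0).trans ((pow_zero _).trans (pow_zero _).symm)
  | succ n => rfl

theorem ladder_mul_K (j : ℤ) :
    ladder q c j * gen q c .K = (((q ^ 2) ^ j : ℂˣ) : ℂ) • (gen q c .K * ladder q c j) := by
  obtain ⟨n, rfl | rfl⟩ := j.eq_nat_or_neg
  · rw [ladder_natCast, pow_mul_of_mul_eq_smul (F_mul_K q c), zpow_natCast,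
      Units.val_pow_eq_pow_val _ n]
  · rw [ladder_neg_natCast, pow_mul_of_mul_eq_smul (E_mul_K q c), zpow_neg, zpow_natCast,
      ← inv_pow (q ^ 2) n, Units.val_pow_eq_pow_val (q ^ 2)⁻¹ n]

/-- The monomials `Kⁱ Fʲ` and `Kⁱ Eʲ` span `U_c`. -/
theorem span_monomials : Submodule.span ℂ (Set.range fun x : Σ _ : ℤ, ℤ =>
    ((KUnit q c ^ x.2 : (Uc q c)ˣ) : Uc q c) * ladder q c x.1) = ⊤ := by
  set S := Submodule.span ℂ (Set.range fun x : Σ _ : ℤ, ℤ =>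
    ((KUnit q c ^ x.2 : (Uc q c)ˣ) : Uc q c) * ladder q c x.1) with hS
  have hmem : ∀ i j : ℤ, ((KUnit q c ^ i : (Uc q c)ˣ) : Uc q c) * ladder q c j ∈ S :=
    fun i j => Submodule.subset_span ⟨⟨j, i⟩, rfl⟩
  have hK : ∀ (k : ℤ) (s : Uc q c), s ∈ S → ((KUnit q c ^ k : (Uc q c)ˣ) : Uc q c) * s ∈ S := by
    intro k s hs
    induction hs using Submodule.span_induction with
    | mem s hs =>
      obtain ⟨⟨j, i⟩, rfl⟩ := hs
      have := hmem (k + i) j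
      rwa [zpow_add, Units.val_mul, mul_assoc] at this
    | zero => simp
    | add a b _ _ ha hb => rw [mul_add]; exact add_mem ha hb
    | smul r a _ ha => rw [mul_smul_comm]; exact Submodule.smul_mem _ _ ha
  have hC : ∀ a ∈ cartan q c, ∀ j, a * ladder q c j ∈ S := by
    intro a ha j
    induction ha using Submodule.span_induction with
    | mem s hs =>
      obtain ⟨i, rfl⟩ := hs
      exact hmem i j
    | zero => simp
    | add a b _ _ ha hb => rw [add_mul]; exact add_mem ha hb
    | smul r a _ ha => rw [smul_mul_assoc]; exact Submodule.smul_mem _ _ ha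
  have h1 : ∀ j, ladder q c j ∈ S := fun j => by simpa using hmem 0 j
  -- F climbs the ladder on powers of F; on Eⁿ⁺¹ the product FE is absorbed into the Cartan part and
  -- leaves Eⁿ. The argument for E is symmetric.
  have hF : ∀ j, gen q c .F * ladder q c j ∈ S := by
    rintro (n | n)
    · have := h1 ((n + 1 : ℕ) : ℤ)
      rwa [ladder_natCast, pow_succ'] at this
    · change gen q c .F * gen q c .E ^ (n + 1) ∈ S
      rw [pow_succ', ← mul_assoc, ← ladder_neg_natCast]
      exact hC _ (F_mul_E_mem_cartan q c) _
  have hE : ∀ j, gen q c .E * ladder q c j ∈ S := by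
    intro j
    obtain ⟨n, rfl | rfl⟩ := j.eq_nat_or_neg
    · cases n with
      | zero =>
        have := h1 (-((1 : ℕ) : ℤ))
        rw [ladder_neg_natCast, pow_one] at this
        rwa [ladder_natCast, pow_zero, mul_one]
      | succ n =>
        rw [ladder_natCast, pow_succ', ← mul_assoc, ← ladder_natCast]
        exact hC _ (E_mul_F_mem_cartan q c) _
    · have := h1 (-((n + 1 : ℕ) : ℤ))
      rwa [ladder_neg_natCast, pow_succ', ← ladder_neg_natCast] at this
  refine Submodule.eq_top_of_adjoin_eq_top (adjoin_range_gen q c) _ ?_ ?_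
  · have := h1 ((0 : ℕ) : ℤ)
    rwa [ladder_natCast, pow_zero] at this
  rintro _ ⟨g, rfl⟩ s hs
  cases g with
  | K =>
    have := hK 1 s hs
    rwa [zpow_one] at this
  | Kinv =>
    have := hK (-1) s hs
    rwa [zpow_neg_one] at this
  | F =>
    induction hs using Submodule.span_induction with
    | mem s hs =>
      obtain ⟨⟨j, i⟩, rfl⟩ := hs
      rw [← mul_assoc, mul_units_zpow_of_mul_eq_smul (q ^ 2) (KUnit q c) _ (F_mul_K q c) i,
        smul_mul_assoc, mul_assoc]
      exact Submodule.smul_mem _ _ (hK _ _ (hF j))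
    | zero => simp
    | add a b _ _ ha hb => rw [mul_add]; exact add_mem ha hb
    | smul r a _ ha => rw [mul_smul_comm]; exact Submodule.smul_mem _ _ ha
  | E =>
    induction hs using Submodule.span_induction with
    | mem s hs =>
      obtain ⟨⟨j, i⟩, rfl⟩ := hs
      rw [← mul_assoc, mul_units_zpow_of_mul_eq_smul (q ^ 2)⁻¹ (KUnit q c) _ (E_mul_K q c) i,
        smul_mul_assoc, mul_assoc]
      exact Submodule.smul_mem _ _ (hK _ _ (hE j))
    | zero => simp
    | add a b _ _ ha hb => rw [mul_add]; exact add_mem ha hb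
    | smul r a _ ha => rw [mul_smul_comm]; exact Submodule.smul_mem _ _ ha

/-! ### U_c inside B: injectivity and denominators. -/

/-- The rational function `p` with `E ↦ p(x) y⁻¹`. -/
def coeffE : TwistedRatFunc (q ^ 2) :=
  c • 1 - (((q : ℂ) - (q : ℂ)⁻¹) ^ 2)⁻¹ •
    ((q : ℂ)⁻¹ • TwistedRatFunc.X (q ^ 2) + (q : ℂ) • (TwistedRatFunc.X (q ^ 2))⁻¹)

theorem toSkewLaurent_gen (g : UqGen) :
    toSkewLaurent q c (gen q c g) = QTorus.toSkewLaurent (q ^ 2) (torusGen q c g) :=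
  congrArg (QTorus.toSkewLaurent (q ^ 2)) (toTorus_gen q c g)

theorem toSkewLaurent_K :
    toSkewLaurent q c (gen q c .K) = SkewLaurent.mono (q ^ 2) (TwistedRatFunc.X _) 0 :=
  (toSkewLaurent_gen q c .K).trans (QTorus.toSkewLaurent_gen _ .x)

theorem toSkewLaurent_F : toSkewLaurent q c (gen q c .F) = SkewLaurent.mono (q ^ 2) 1 1 :=
  (toSkewLaurent_gen q c .F).trans (QTorus.toSkewLaurent_gen _ .y)

theorem toSkewLaurent_E :
    toSkewLaurent q c (gen q c .E) = SkewLaurent.mono (q ^ 2) (coeffE q c) (-1) := by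
  rw [toSkewLaurent_gen]
  simp only [torusGen, map_sub, map_smul, map_mul, map_add, QTorus.toSkewLaurent_gen,
    SkewLaurent.torusGen]
  have h : SkewLaurent.mono (q ^ 2) (coeffE q c) (-1) =
      SkewLaurent.ofRatFunc (q ^ 2) (coeffE q c) * SkewLaurent.mono (q ^ 2) 1 (-1) := by
    rw [SkewLaurent.ofRatFunc_apply, SkewLaurent.mono_mul_mono]
    simp
  rw [h, coeffE]
  simp only [map_sub, map_smul, map_add, map_one, sub_mul, smul_mul_assoc, one_mul]
  rfl

variable {q}

theorem zpow_injective (hq : ∀ n : ℕ, 0 < n → q ^ n ≠ 1) :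
    Function.Injective fun i : ℤ => ((q ^ 2 : ℂˣ) : ℂ) ^ i := by
  have key : ∀ n : ℕ, 0 < n → (q ^ 2) ^ n ≠ 1 := fun n hn => by
    rw [← pow_mul]
    exact hq _ (by omega)
  have h0 : ¬ IsOfFinOrder (q ^ 2) := by
    rw [isOfFinOrder_iff_pow_eq_one]
    rintro ⟨n, hn, h⟩
    exact key n hn h
  intro i j hij
  have h : (q ^ 2) ^ i = (q ^ 2) ^ j := Units.ext (by simpa using hij)
  exact injective_zpow_iff_not_isOfFinOrder.2 h0 h

theorem sub_inv_ne_zero (hq : ∀ n : ℕ, 0 < n → q ^ n ≠ 1) : (q : ℂ) - (q : ℂ)⁻¹ ≠ 0 := by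
  intro h
  apply hq 2 two_pos
  ext
  have hq0 : (q : ℂ) ≠ 0 := q.ne_zero
  rw [sub_eq_zero] at h
  rw [Units.val_pow_eq_pow_val, sq]
  nth_rewrite 2 [h]
  simp

/-- The functions 1, x, x⁻¹ are independent, and the coefficient of x is −q⁻¹/(q − q⁻¹)², nonzero
whatever `c` is. -/
theorem coeffE_ne_zero (hq : ∀ n : ℕ, 0 < n → q ^ n ≠ 1) : coeffE q c ≠ 0 := by
  intro h
  have hli := linearIndependent_iff'.1 (TwistedRatFunc.linearIndependent_zpow_X (zpow_injective hq))
  set d := (((q : ℂ) - (q : ℂ)⁻¹) ^ 2)⁻¹ with hd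
  have hd0 : d ≠ 0 := inv_ne_zero (pow_ne_zero 2 (sub_inv_ne_zero hq))
  have h1 := hli {0, 1, -1}
    (fun i => if i = 0 then c else if i = 1 then -(d * (q : ℂ)⁻¹) else -(d * q)) ?_ 1 (by simp)
  · simp [hd0] at h1
  · rw [Finset.sum_insert (by simp), Finset.sum_insert (by simp), Finset.sum_singleton, ← h,
      coeffE, ← hd]
    simp only [if_true, one_ne_zero, if_false, zpow_zero, zpow_one, zpow_neg,
      show ((-1 : ℤ) = 0) = False by simp, show ((-1 : ℤ) = 1) = False by simp]
    module

/-- F maps to y and E to a nonzero multiple of y⁻¹, so every y-degree is reached by a nonzero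
monomial. Both the injectivity of U_c → B and the localization property rest on this. -/
theorem exists_toSkewLaurent_ladder (hq : ∀ n : ℕ, 0 < n → q ^ n ≠ 1) (j : ℤ) :
    ∃ p, p ≠ 0 ∧ toSkewLaurent q c (ladder q c j) = SkewLaurent.mono (q ^ 2) p j := by
  obtain ⟨n, rfl | rfl⟩ := j.eq_nat_or_neg
  · rw [ladder_natCast, map_pow, toSkewLaurent_F]
    refine ⟨1, one_ne_zero, ?_⟩
    induction n with
    | zero => rfl
    | succ n ih => rw [pow_succ _ n, ih, SkewLaurent.mono_mul_mono, map_one, mul_one, Nat.cast_succ]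
  · rw [ladder_neg_natCast, map_pow, toSkewLaurent_E]
    induction n with
    | zero => exact ⟨1, one_ne_zero, rfl⟩
    | succ n ih =>
      obtain ⟨p, hp, e⟩ := ih
      rw [pow_succ _ n, e, SkewLaurent.mono_mul_mono]
      refine ⟨_, mul_ne_zero hp ?_, by rw [Nat.cast_succ, neg_add]⟩
      simpa using coeffE_ne_zero c hq

theorem toSkewLaurent_injective (hq : ∀ n : ℕ, 0 < n → q ^ n ≠ 1) :
    Function.Injective (toSkewLaurent q c) := by
  choose p hp e using exists_toSkewLaurent_ladder c hq
  refine LinearMap.injective_of_span_of_linearIndependent (toSkewLaurent q c).toLinearMap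
    (span_monomials q c) (SkewLaurent.linearIndependent_mono (zpow_injective hq) hp) fun x => ?_
  rw [AlgHom.toLinearMap_apply, map_mul, e,
    SkewLaurent.map_units_zpow_eq_mono _ _ (toSkewLaurent_K q c), SkewLaurent.mono_mul_mono]
  simp

theorem toTorus_injective (hq : ∀ n : ℕ, 0 < n → q ^ n ≠ 1) :
    Function.Injective (toTorus q c) :=
  Function.Injective.of_comp (f := QTorus.toSkewLaurent (q ^ 2)) (toSkewLaurent_injective c hq)

theorem toSkewLaurent_aeval_K (s : Polynomial ℂ) :
    toSkewLaurent q c (Polynomial.aeval (gen q c .K) s) =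
      SkewLaurent.mono (q ^ 2) (algebraMap (Polynomial ℂ) _ s) 0 := by
  rw [← Polynomial.aeval_algHom_apply, toSkewLaurent_K, SkewLaurent.aeval_mono_X]

/-- `B` is the localization of `R_c` at the nonzero polynomials in `x`. -/
theorem exists_denominator (hq : ∀ n : ℕ, 0 < n → q ^ n ≠ 1) (b : SkewLaurent (q ^ 2)) :
    ∃ s : Polynomial ℂ, s ≠ 0 ∧ ∃ u : Uc q c,
      SkewLaurent.mono (q ^ 2) (algebraMap (Polynomial ℂ) _ s) 0 * b = toSkewLaurent q c u := by
  induction b using SkewLaurent.induction_mono with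
  | zero => exact ⟨1, one_ne_zero, 0, by simp⟩
  | mono f n =>
    obtain ⟨p, hp, e⟩ := exists_toSkewLaurent_ladder c hq n
    -- With f/p = a/s one has s f yⁿ = a p yⁿ, the image of a(K) times the ladder element of degree
    -- n.
    obtain ⟨a, s, hs, h⟩ := IsFractionRing.div_surjective (A := Polynomial ℂ) (f / p)
    have hs0 : s ≠ 0 := nonZeroDivisors.ne_zero hs
    have hs1 : algebraMap (Polynomial ℂ) (TwistedRatFunc (q ^ 2)) s ≠ 0 := by
      rwa [Ne, FaithfulSMul.algebraMap_eq_zero_iff]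
    refine ⟨s, hs0, Polynomial.aeval (gen q c .K) a * ladder q c n, ?_⟩
    rw [map_mul, e, toSkewLaurent_aeval_K, SkewLaurent.mono_mul_mono, SkewLaurent.mono_mul_mono]
    congr 1
    · rw [div_eq_div_iff hs1 hp] at h
      simp only [zpow_zero, AlgEquiv.one_apply]
      rw [h, mul_comm]
  | add a b ha hb =>
    obtain ⟨s, hs, u, hu⟩ := ha
    obtain ⟨t, ht, w, hw⟩ := hb
    refine ⟨s * t, mul_ne_zero hs ht,
      Polynomial.aeval (gen q c .K) t * u + Polynomial.aeval (gen q c .K) s * w, ?_⟩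
    rw [← toSkewLaurent_aeval_K c] at hu hw ⊢
    rw [map_add, map_mul (toSkewLaurent q c), map_mul (toSkewLaurent q c), ← hu, ← hw,
      ← mul_assoc, ← mul_assoc, ← map_mul (toSkewLaurent q c), ← map_mul (toSkewLaurent q c),
      ← map_mul, ← map_mul, mul_comm t s, mul_add]

end Uc

/-! ### Simple modules with a weight vector. -/

namespace Uc

variable {q : ℂˣ} (c : ℂ)

section Weights

variable {V : Type*} [AddCommGroup V] [Module ℂ V] [Module (Uc q c) V]
  [IsScalarTower ℂ (Uc q c) V]

theorem mem_weightSpace {μ : ℂ} {v : V} : v ∈ weightSpace q c V μ ↔ gen q c .K • v = μ • v :=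
  Module.End.mem_eigenspace_iff

/-- If some nonzero polynomial in `K` kills a nonzero vector, then `K` has an eigenvector. -/
theorem exists_mem_weightSpace (s : Polynomial ℂ) (hs : s ≠ 0) (v : V) (hv : v ≠ 0)
    (h : Polynomial.aeval (gen q c .K) s • v = 0) :
    ∃ (μ : ℂ) (w : V), w ≠ 0 ∧ w ∈ weightSpace q c V μ := by
  induction hn : s.natDegree generalizing s with
  | zero =>
    rw [Polynomial.eq_C_of_natDegree_eq_zero hn, Polynomial.aeval_C, algebraMap_smul,
      smul_eq_zero] at h
    refine absurd ?_ hs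
    rw [Polynomial.eq_C_of_natDegree_eq_zero hn, h.resolve_right hv, Polynomial.C_0]
  | succ n ih =>
    -- Write s = (X − a)t. Either t(K) already kills `v` and the degree drops, or t(K)v is an
    -- eigenvector with eigenvalue `a`.
    obtain ⟨a, ha⟩ := IsAlgClosed.exists_root s fun h0 => by
      rw [Polynomial.natDegree_eq_zero_iff_degree_le_zero.2 h0.le] at hn
      omega
    obtain ⟨t, rfl⟩ := Polynomial.dvd_iff_isRoot.2 ha
    by_cases ht : Polynomial.aeval (gen q c .K) t • v = 0
    · have ht0 := right_ne_zero_of_mul hs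
      refine ih t ht0 ht ?_
      rw [Polynomial.natDegree_mul (Polynomial.X_sub_C_ne_zero a) ht0,
        Polynomial.natDegree_X_sub_C] at hn
      omega
    · refine ⟨a, _, ht, (mem_weightSpace c).2 ?_⟩
      rw [map_mul, mul_smul, map_sub, Polynomial.aeval_X, Polynomial.aeval_C, sub_smul,
        algebraMap_smul, sub_eq_zero] at h
      exact h

theorem Kinv_smul {μ : ℂ} {v : V} (hμ : μ ≠ 0) (hv : v ∈ weightSpace q c V μ) :
    gen q c .Kinv • v = μ⁻¹ • v := by
  rw [mem_weightSpace] at hv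
  have h := congrArg (gen q c .Kinv • ·) hv
  simp only [smul_smul, Kinv_mul_K, one_smul, smul_algebra_smul_comm] at h
  rw [eq_inv_smul_iff₀ hμ]
  exact h.symm

theorem weight_ne_zero {μ : ℂ} {v : V} (hv0 : v ≠ 0) (hv : v ∈ weightSpace q c V μ) : μ ≠ 0 := by
  rintro rfl
  rw [mem_weightSpace, zero_smul] at hv
  apply hv0
  rw [← one_smul (Uc q c) v, ← Kinv_mul_K, mul_smul, hv, smul_zero]

/-- F multiplies weights by q⁻² and E by q², hence the sign of the exponent: the vector of weight
μq²ⁱ is reached by the ladder element of index −i. -/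
theorem ladder_smul_mem {μ : ℂ} {v : V} (hv : v ∈ weightSpace q c V μ) (j : ℤ) :
    ladder q c j • v ∈ weightSpace q c V (μ * (q : ℂ) ^ (2 * -j)) := by
  rw [mem_weightSpace] at hv ⊢
  have h := congrArg (· • v) (ladder_mul_K q c j)
  simp only [mul_smul, hv, smul_assoc] at h
  rw [smul_algebra_smul_comm] at h
  have e : ((q : ℂ) ^ (2 : ℤ)) ^ (-j) * (((q ^ 2) ^ j : ℂˣ) : ℂ) = 1 := by
    rw [Units.val_zpow_eq_zpow_val, Units.val_pow_eq_pow_val, zpow_neg]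
    exact inv_mul_cancel₀ (zpow_ne_zero _ (zpow_ne_zero _ q.ne_zero))
  rw [zpow_mul, mul_comm, mul_smul _ μ, h, smul_smul (((q : ℂ) ^ (2 : ℤ)) ^ (-j)), e, one_smul]

theorem KUnit_zpow_smul {μ : ℂ} {v : V} (hμ : μ ≠ 0) (hv : v ∈ weightSpace q c V μ) (i : ℤ) :
    ((KUnit q c ^ i : (Uc q c)ˣ) : Uc q c) • v = μ ^ i • v := by
  obtain ⟨n, rfl | rfl⟩ := i.eq_nat_or_neg
  · rw [zpow_natCast, zpow_natCast, Units.val_pow_eq_pow_val]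
    change gen q c .K ^ n • v = _
    rw [mem_weightSpace] at hv
    induction n with
    | zero => simp
    | succ n ih =>
      rw [pow_succ (gen q c .K) n, mul_smul, hv, smul_algebra_smul_comm, ih, smul_smul,
        pow_succ' μ n]
  · rw [zpow_neg, zpow_neg, zpow_natCast, zpow_natCast, ← inv_pow, Units.val_pow_eq_pow_val]
    change gen q c .Kinv ^ n • v = _
    have h := Kinv_smul c hμ hv
    rw [← inv_pow]
    induction n with
    | zero => simp
    | succ n ih =>
      rw [pow_succ (gen q c .Kinv) n, mul_smul, h, smul_algebra_smul_comm, ih, smul_smul,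
        pow_succ' μ⁻¹ n]

theorem zpow_two_mul_injective (hq : ∀ n : ℕ, 0 < n → q ^ n ≠ 1) {μ : ℂ} (hμ : μ ≠ 0) :
    Function.Injective fun i : ℤ => μ * (q : ℂ) ^ (2 * i) := by
  intro i j h
  refine zpow_injective hq ?_
  have h2 := mul_left_cancel₀ hμ h
  rw [zpow_mul, zpow_mul] at h2
  rw [Units.val_pow_eq_pow_val]
  exact h2

/-- A simple module with a weight vector is a lowest weight module, a highest weight module or a
module of the intermediate series. -/
theorem isWeightModule (hq : ∀ n : ℕ, 0 < n → q ^ n ≠ 1) [IsSimpleModule (Uc q c) V]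
    {μ : ℂ} {v : V} (hv0 : v ≠ 0) (hv : v ∈ weightSpace q c V μ) :
    IsLowestWeight q c V ∨ IsHighestWeight q c V ∨ IsIntermediateSeries q c V := by
  by_cases hF : ∃ (μ' : ℂ) (w : V), w ≠ 0 ∧ w ∈ weightSpace q c V μ' ∧ gen q c .F • w = 0
  · obtain ⟨μ', w, h0, hw, h⟩ := hF
    exact Or.inl ⟨μ', w, h0, hw, h, IsSimpleModule.span_singleton_eq_top _ h0⟩
  by_cases hE : ∃ (μ' : ℂ) (w : V), w ≠ 0 ∧ w ∈ weightSpace q c V μ' ∧ gen q c .E • w = 0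
  · obtain ⟨μ', w, h0, hw, h⟩ := hE
    exact Or.inr (Or.inl ⟨μ', w, h0, hw, h, IsSimpleModule.span_singleton_eq_top _ h0⟩)
  refine Or.inr (Or.inr ?_)
  have hμ : μ ≠ 0 := weight_ne_zero c hv0 hv
  -- A first vanishing step along the ladder would exhibit a nonzero weight vector killed by F or by
  -- E, which has been excluded.
  have hne : ∀ j, ladder q c j • v ≠ 0 := by
    intro j
    obtain ⟨n, rfl | rfl⟩ := j.eq_nat_or_neg
    · induction n with
      | zero => rwa [ladder_natCast, pow_zero, one_smul]
      | succ n ih =>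
        intro h
        refine hF ⟨_, _, ih, ladder_smul_mem c hv n, ?_⟩
        rwa [ladder_natCast, pow_succ', mul_smul, ← ladder_natCast] at h
    · induction n with
      | zero => rwa [ladder_neg_natCast, pow_zero, one_smul]
      | succ n ih =>
        intro h
        refine hE ⟨_, _, ih, ladder_smul_mem c hv _, ?_⟩
        rwa [ladder_neg_natCast, pow_succ', mul_smul, ← ladder_neg_natCast] at h
  set W : ℤ → Submodule ℂ V := fun i => weightSpace q c V (μ * (q : ℂ) ^ (2 * i)) with hW
  set L : ℤ → Submodule ℂ V := fun i => Submodule.span ℂ {ladder q c (-i) • v} with hL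
  have hLW : ∀ i, L i ≤ W i := fun i => by
    rw [hL, hW, Submodule.span_singleton_le_iff_mem]
    have := ladder_smul_mem c hv (-i)
    rwa [neg_neg] at this
  have hLtop : ⨆ i, L i = ⊤ := by
    refine eq_top_iff.2 fun x _ => ?_
    have hx : x ∈ Submodule.span (Uc q c) {v} := by
      rw [IsSimpleModule.span_singleton_eq_top _ hv0]
      exact Submodule.mem_top
    obtain ⟨a, rfl⟩ := Submodule.mem_span_singleton.1 hx
    have ha : a ∈ Submodule.span ℂ _ := (span_monomials q c).symm ▸ Submodule.mem_top
    induction ha using Submodule.span_induction with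
    | mem s hs =>
      obtain ⟨⟨j, i⟩, rfl⟩ := hs
      refine Submodule.mem_iSup_of_mem (-j) ?_
      rw [mul_smul, KUnit_zpow_smul c (weight_ne_zero c (hne j) (ladder_smul_mem c hv j))
        (ladder_smul_mem c hv j), hL]
      simp only [neg_neg]
      exact Submodule.smul_mem _ _ (Submodule.mem_span_singleton_self _)
    | zero => rw [zero_smul]; exact zero_mem _
    | add a b _ _ ha hb =>
      rw [add_smul]
      exact add_mem (ha trivial (Submodule.smul_mem _ _ (Submodule.mem_span_singleton_self _)))
        (hb trivial (Submodule.smul_mem _ _ (Submodule.mem_span_singleton_self _)))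
    | smul r a _ ha =>
      rw [smul_assoc]
      exact Submodule.smul_mem _ _
        (ha trivial (Submodule.smul_mem _ _ (Submodule.mem_span_singleton_self _)))
  have hind : iSupIndep W :=
    (Module.End.eigenspaces_iSupIndep (Algebra.lsmul ℂ ℂ V (gen q c .K))).comp
      (zpow_two_mul_injective hq hμ)
  -- The lines `L i` lie in the independent spaces `W i` and already sum to V. By the modular law,
  -- intersecting `L i` plus the remaining lines with `W i` leaves only `L i`.
  have heq : ∀ i, W i = L i := fun i => by
    have h1 : L i ⊔ (⨆ j, ⨆ (_ : j ≠ i), L j) = ⊤ := by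
      rw [← hLtop]
      refine le_antisymm (sup_le (le_iSup L i) (iSup₂_le fun j _ => le_iSup L j))
        (iSup_le fun j => ?_)
      by_cases h : j = i
      · exact h ▸ le_sup_left
      · exact le_sup_of_le_right (le_iSup₂_of_le j h le_rfl)
    have h2 : (⨆ j, ⨆ (_ : j ≠ i), L j) ⊓ W i = ⊥ := by
      rw [inf_comm, ← disjoint_iff]
      exact (hind i).mono_right (iSup₂_mono fun j _ => hLW j)
    have h3 := sup_inf_assoc_of_le (⨆ j, ⨆ (_ : j ≠ i), L j) (hLW i)
    rw [h1, h2, top_inf_eq, sup_bot_eq] at h3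
    exact h3
  refine ⟨μ, hμ, fun i => ?_, ?_⟩
  · change Module.finrank ℂ (W i) = 1
    rw [heq]
    exact finrank_span_singleton (hne (-i))
  · change ⨆ i, W i = ⊤
    rw [← hLtop]
    exact iSup_congr heq

end Weights

/-! ### Localization of left ideals and torsion-free simple modules. -/

/-- The left ideal `S⁻¹ φ(I)` of `B`, for a left ideal `I` of `U_c`. -/
def localize (hq : ∀ n : ℕ, 0 < n → q ^ n ≠ 1) (I : Ideal (Uc q c)) :
    Ideal (SkewLaurent (q ^ 2)) where
  carrier := {b | ∃ s : Polynomial ℂ, s ≠ 0 ∧ ∃ u ∈ I,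
    SkewLaurent.mono (q ^ 2) (algebraMap (Polynomial ℂ) _ s) 0 * b = toSkewLaurent q c u}
  zero_mem' := ⟨1, one_ne_zero, 0, zero_mem _, by simp⟩
  add_mem' := by
    rintro a b ⟨s, hs, u, huI, hu⟩ ⟨t, ht, w, hwI, hw⟩
    refine ⟨s * t, mul_ne_zero hs ht,
      Polynomial.aeval (gen q c .K) t * u + Polynomial.aeval (gen q c .K) s * w,
      add_mem (Ideal.mul_mem_left _ _ huI) (Ideal.mul_mem_left _ _ hwI), ?_⟩
    rw [← toSkewLaurent_aeval_K c] at hu hw ⊢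
    rw [map_add, map_mul (toSkewLaurent q c), map_mul (toSkewLaurent q c), ← hu, ← hw,
      ← mul_assoc, ← mul_assoc, ← map_mul (toSkewLaurent q c), ← map_mul (toSkewLaurent q c),
      ← map_mul, ← map_mul, mul_comm t s, mul_add]
  smul_mem' := by
    rintro a b ⟨s, hs, u, huI, hu⟩
    have hs1 : algebraMap (Polynomial ℂ) (TwistedRatFunc (q ^ 2)) s ≠ 0 := by
      rwa [Ne, FaithfulSMul.algebraMap_eq_zero_iff]
    -- Ore condition: rewriting a s⁻¹ as t⁻¹φ(w) turns ab = a s⁻¹φ(u) into t⁻¹φ(wu).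
    obtain ⟨t, ht, w, hw⟩ := exists_denominator c hq
      (a * SkewLaurent.mono (q ^ 2) (algebraMap (Polynomial ℂ) (TwistedRatFunc (q ^ 2)) s)⁻¹ 0)
    refine ⟨t, ht, w * u, Ideal.mul_mem_left _ _ huI, ?_⟩
    have h1 : SkewLaurent.mono (q ^ 2) (algebraMap (Polynomial ℂ) (TwistedRatFunc (q ^ 2)) s)⁻¹ 0 *
        (SkewLaurent.mono (q ^ 2) (algebraMap (Polynomial ℂ) (TwistedRatFunc (q ^ 2)) s) 0 * b) =
        b := by
      rw [← mul_assoc, SkewLaurent.mono_mul_mono]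
      simp only [zpow_zero, AlgEquiv.one_apply, inv_mul_cancel₀ hs1, add_zero]
      rw [← SkewLaurent.one_eq_mono, one_mul]
    rw [map_mul, ← hw, ← hu, smul_eq_mul]
    simp only [mul_assoc]
    rw [h1]

theorem mem_localize (hq : ∀ n : ℕ, 0 < n → q ^ n ≠ 1) {I : Ideal (Uc q c)}
    {b : SkewLaurent (q ^ 2)} : b ∈ localize c hq I ↔ ∃ s : Polynomial ℂ, s ≠ 0 ∧ ∃ u ∈ I,
      SkewLaurent.mono (q ^ 2) (algebraMap (Polynomial ℂ) _ s) 0 * b = toSkewLaurent q c u :=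
  Iff.rfl

/-- Multiplying an element of J by its denominator keeps it in J and brings it into R_c, so
contraction to U_c loses nothing. -/
theorem le_localize_comap (hq : ∀ n : ℕ, 0 < n → q ^ n ≠ 1) (J : Ideal (SkewLaurent (q ^ 2))) :
    J ≤ localize c hq (J.comap (toSkewLaurent q c)) := by
  intro b hb
  obtain ⟨s, hs, u, hu⟩ := exists_denominator c hq b
  refine ⟨s, hs, u, ?_, hu⟩
  rw [Ideal.mem_comap, ← hu]
  exact Ideal.mul_mem_left _ _ hb

theorem le_comap_localize (hq : ∀ n : ℕ, 0 < n → q ^ n ≠ 1) (I : Ideal (Uc q c)) :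
    I ≤ (localize c hq I).comap (toSkewLaurent q c) := fun u hu =>
  ⟨1, one_ne_zero, u, hu, by rw [map_one, ← SkewLaurent.one_eq_mono, one_mul]⟩

/-- A maximal left ideal of `U_c` is nonzero. -/
theorem ne_bot_of_isMaximal {I : Ideal (Uc q c)}
    (hI : I.IsMaximal) : I ≠ ⊥ := by
  rintro rfl
  set J : Ideal (SkewLaurent (q ^ 2)) := Ideal.span {1 + SkewLaurent.mono (q ^ 2) 1 1} with hJ
  have hmem : 1 + gen q c .F ∈ J.comap (toSkewLaurent q c) := by
    rw [Ideal.mem_comap, map_add, map_one, toSkewLaurent_F]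
    exact Ideal.mem_span_singleton_self _
  -- The contraction of B(1 + y) contains 1 + F ≠ 0. Were the zero ideal maximal, the contraction
  -- would be all of U_c, which would put 1 in B(1 + y).
  have htop : J.comap (toSkewLaurent q c) = ⊤ := by
    by_contra h
    rw [← hI.eq_of_le h bot_le, Ideal.mem_bot] at hmem
    have h0 : 1 + SkewLaurent.mono (q ^ 2) 1 1 = 0 := by
      rw [← toSkewLaurent_F q c, ← map_one (toSkewLaurent q c), ← map_add, hmem, map_zero]
    have h1 := congrArg (SkewLaurent.coeffAt (q ^ 2) 1) h0
    rw [SkewLaurent.one_eq_mono, map_add, SkewLaurent.coeffAt_mono, SkewLaurent.coeffAt_mono] at h1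
    simp at h1
  have h1 : (1 : SkewLaurent (q ^ 2)) ∈ J := by
    have : (1 : Uc q c) ∈ J.comap (toSkewLaurent q c) := htop ▸ Submodule.mem_top
    rwa [Ideal.mem_comap, map_one] at this
  obtain ⟨a, ha⟩ := Ideal.mem_span_singleton'.1 h1
  exact SkewLaurent.mul_one_add_y_ne_one a ha

/-- A simple module on which nonzero polynomials in `K` act injectively is isomorphic to
`(R_c + Bα)/Bα` for an irreducible `α ∈ R_c`. -/
theorem exists_irreducible {V : Type*} [AddCommGroup V] [Module (Uc q c) V]
    (hq : ∀ n : ℕ, 0 < n → q ^ n ≠ 1) [IsSimpleModule (Uc q c) V]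
    (htf : ∀ s : Polynomial ℂ, s ≠ 0 → ∀ v : V, Polynomial.aeval (gen q c .K) s • v = 0 → v = 0) :
    ∃ α : image q c, Irreducible (α : SkewLaurent (q ^ 2)) ∧
      ∃ e : V ≃+ cyclicModule q c (α : SkewLaurent (q ^ 2)),
        ∀ (u : Uc q c) (v : V), e (u • v) = toImage q c u • e v := by
  have := IsSimpleModule.nontrivial (Uc q c) V
  obtain ⟨v, hv⟩ := exists_ne (0 : V)
  set f : Uc q c →ₗ[Uc q c] V := LinearMap.toSpanSingleton (Uc q c) V v with hf
  have hfs : Function.Surjective f := IsSimpleModule.toSpanSingleton_surjective (Uc q c) hv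
  set I : Ideal (Uc q c) := LinearMap.ker f with hI
  have hmax : I.IsMaximal := IsSimpleModule.ker_toSpanSingleton_isMaximal (Uc q c) hv
  -- If s(K)w lies in `I`, then s(K) kills the vector wv, so wv = 0 by torsion-freeness and w lies
  -- in `I`.
  have hcomap : (localize c hq I).comap (toSkewLaurent q c) = I := by
    refine le_antisymm (fun w hw => ?_) (le_comap_localize c hq I)
    obtain ⟨s, hs, u, hu, e⟩ := (mem_localize c hq).1 (Ideal.mem_comap.1 hw)
    rw [← toSkewLaurent_aeval_K c, ← map_mul] at e
    have e' := toSkewLaurent_injective c hq e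
    refine LinearMap.mem_ker.2 (htf s hs _ ?_)
    rw [← smul_eq_mul] at e'
    rw [← map_smul, e']
    exact hu
  obtain ⟨β, hβ⟩ := SkewLaurent.exists_eq_span_singleton (localize c hq I)
  -- Clearing the denominator of the generator multiplies it on the left by a unit of B, so the left
  -- ideal is unchanged and the new generator lies in R_c.
  obtain ⟨t, ht, a, ha⟩ := exists_denominator c hq β
  have hunit : IsUnit (SkewLaurent.mono (q ^ 2) (algebraMap (Polynomial ℂ) _ t) 0) :=
    SkewLaurent.isUnit_mono (by rwa [Ne, FaithfulSMul.algebraMap_eq_zero_iff])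
  set α : SkewLaurent (q ^ 2) := toSkewLaurent q c a with hα
  have hspan : localize c hq I = Ideal.span {α} := by
    rw [hβ, ← ha, Ideal.span_singleton_mul_left_unit hunit]
  have hcm : (Ideal.span {α}).comap (toSkewLaurent q c) = I := hspan ▸ hcomap
  have hα0 : α ≠ 0 := by
    intro h0
    obtain ⟨u, hu, hu0⟩ := Submodule.exists_mem_ne_zero_of_ne_bot (ne_bot_of_isMaximal c hmax)
    rw [← hcm, Ideal.mem_comap, h0, Ideal.span_singleton_zero, Ideal.mem_bot] at hu
    exact hu0 (toSkewLaurent_injective c hq (hu.trans (map_zero _).symm))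
  have hirr : Irreducible α := by
    refine ⟨fun hu => hmax.ne_top ?_, fun x y hxy => ?_⟩
    · rw [← hcm, Ideal.eq_top_of_isUnit_mem _ (Ideal.mem_span_singleton_self α) hu,
        Ideal.comap_top]
    · have hle : Ideal.span {α} ≤ Ideal.span {y} := by
        rw [Ideal.span_singleton_le_iff_mem, hxy]
        exact Ideal.mul_mem_left _ _ (Ideal.mem_span_singleton_self y)
      -- For α = xy, the contraction of By contains the maximal ideal `I`. If it is everything, then
      -- 1 ∈ By and y is a unit. Otherwise it is `I`, so By lies in the localization Bα of `I`, and
      -- cancelling y shows that x is a unit.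
      by_cases htop : (Ideal.span {y}).comap (toSkewLaurent q c) = ⊤
      · right
        have h1 : (1 : Uc q c) ∈ (Ideal.span {y}).comap (toSkewLaurent q c) :=
          htop ▸ Submodule.mem_top
        rw [Ideal.mem_comap, map_one] at h1
        obtain ⟨z, hz⟩ := Ideal.mem_span_singleton'.1 h1
        exact SkewLaurent.isUnit_of_mul_eq_one_left hz
      · left
        have hIy : I = (Ideal.span {y}).comap (toSkewLaurent q c) :=
          hmax.eq_of_le htop (hcm ▸ Ideal.comap_mono hle)
        have hy : y ∈ Ideal.span {α} := by
          rw [← hspan, hIy]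
          exact le_localize_comap c hq _ (Ideal.mem_span_singleton_self y)
        obtain ⟨d, hd⟩ := Ideal.mem_span_singleton'.1 hy
        have hy0 : y ≠ 0 := by
          rintro rfl
          exact hα0 (by rw [hxy, mul_zero])
        have h1 : (d * x - 1) * y = 0 := by
          rw [sub_mul, mul_assoc, ← hxy, hd, one_mul, sub_self]
        have h2 : d * x = 1 := sub_eq_zero.1 ((mul_eq_zero.1 h1).resolve_right hy0)
        exact SkewLaurent.isUnit_of_mul_eq_one_left h2
  refine ⟨⟨α, a, rfl⟩, hirr, ?_⟩
  change ∃ e : V ≃+ cyclicModule q c α, _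
  have hgmem : ∀ u, (Ideal.span {α}).mkQ (toSkewLaurent q c u) ∈ cyclicModule q c α := fun u =>
    Submodule.mem_map.2 ⟨_, Submodule.mem_sup_left ⟨u, rfl⟩, rfl⟩
  let g : Uc q c →+ cyclicModule q c α :=
    { toFun := fun u => ⟨_, hgmem u⟩
      map_zero' := Subtype.ext (by simp)
      map_add' := fun u w => Subtype.ext (by simp) }
  have hgs : Function.Surjective g := by
    rintro ⟨x, hx⟩
    obtain ⟨b, hb, rfl⟩ := Submodule.mem_map.1 hx
    obtain ⟨r, ⟨u, rfl⟩, s, hs, rfl⟩ := Submodule.mem_sup.1 hb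
    refine ⟨u, Subtype.ext ?_⟩
    change (Ideal.span {α}).mkQ (toSkewLaurent q c u) = (Ideal.span {α}).mkQ (_ + s)
    have hs0 : (Ideal.span {α}).mkQ s = 0 := (Submodule.Quotient.mk_eq_zero _).2 hs
    rw [map_add, hs0, add_zero]
    rfl
  -- Both V and the cyclic module are quotients of U_c, and both kernels are the contraction of Bα,
  -- that is, `I`.
  have hker : f.toAddMonoidHom.ker = g.ker := by
    ext u
    have h1 : u ∈ g.ker ↔ toSkewLaurent q c u ∈ Ideal.span {α} := by
      rw [AddMonoidHom.mem_ker, ← Submodule.Quotient.mk_eq_zero]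
      exact Subtype.ext_iff
    rw [h1, ← Ideal.mem_comap, hcm]
    rfl
  let e : V ≃+ cyclicModule q c α :=
    ((QuotientAddGroup.quotientKerEquivOfSurjective f.toAddMonoidHom hfs).symm.trans
      (QuotientAddGroup.quotientAddEquivOfEq hker)).trans
      (QuotientAddGroup.quotientKerEquivOfSurjective g hgs)
  have he : ∀ u, e (f u) = g u := by
    intro u
    have : (QuotientAddGroup.quotientKerEquivOfSurjective f.toAddMonoidHom hfs).symm (f u) =
        QuotientAddGroup.mk u := by
      rw [AddEquiv.symm_apply_eq]
      rfl
    simp only [e, AddEquiv.trans_apply]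
    rw [this]
    rfl
  refine ⟨e, fun u x => ?_⟩
  obtain ⟨w, rfl⟩ := hfs x
  rw [← map_smul, he, he]
  refine Subtype.ext ?_
  change (Ideal.span {α}).mkQ (toSkewLaurent q c (u * w)) = _
  rw [map_mul]
  rfl

end Uc

end

theorem theorem4p3 (q : ℂˣ) (hq : ∀ n : ℕ, 0 < n → q ^ n ≠ 1) (c : ℂ) :
    Function.Injective (Uc.toTorus q c) ∧
    Function.Injective (QTorus.toSkewLaurent (q ^ 2)) ∧
    ∀ (V : Type*) [AddCommGroup V] [Module ℂ V] [Module (Uc q c) V]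
      [IsScalarTower ℂ (Uc q c) V] [IsSimpleModule (Uc q c) V],
      Uc.IsLowestWeight q c V ∨
      Uc.IsHighestWeight q c V ∨
      Uc.IsIntermediateSeries q c V ∨
      ∃ α : Uc.image q c, Irreducible (α : SkewLaurent (q ^ 2)) ∧
        ∃ e : V ≃+ Uc.cyclicModule q c (α : SkewLaurent (q ^ 2)),
          ∀ (u : Uc q c) (v : V), e (u • v) = Uc.toImage q c u • e v := by
  refine ⟨Uc.toTorus_injective c hq, QTorus.toSkewLaurent_injective (Uc.zpow_injective hq), ?_⟩
  intro V _ _ _ _ _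
  -- The dichotomy: V is torsion-free over ℂ[K], or a torsion vector yields a weight vector.
  by_cases htf : ∀ s : Polynomial ℂ, s ≠ 0 → ∀ v : V,
      Polynomial.aeval (Uc.gen q c .K) s • v = 0 → v = 0
  · exact Or.inr (Or.inr (Or.inr (Uc.exists_irreducible c hq htf)))
  · push Not at htf
    obtain ⟨s, hs, v, hsv, hv⟩ := htf
    obtain ⟨μ, w, hw0, hw⟩ := Uc.exists_mem_weightSpace c s hs v hv hsv
    rcases Uc.isWeightModule c hq hw0 hw with h | h | h
    · exact Or.inl h
    · exact Or.inr (Or.inl h)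
    · exact Or.inr (Or.inr (Or.inl h))
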